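/- Let $\Phi$ denote the standard normal c.d.f. For $\beta_0\in\mathbb{R}$ and $\gamma_0\ge 0$ put $h=\mathbb{E}[\Phi(-|\beta_0+\gamma_0 Z|)]$ with $Z\sim N(0,1)$. Then the equation $$r+\big(2r\ln(e/r)\big)^{1/2}=h$$ has exactly one solution $r\in(0,1)$, and for every $\bar r\in(0,r)$ there is a constant $c>0$, depending only on $\beta_0,\gamma_0,\bar r$ (and not on $n$ or $d$), such that the following holds for all integers $n\ge 1$ and $d\ge 0$ with $(d+1)/n\le\bar r$. Let $x_1,\dots,x_n$ be i.i.d. $N(0,I_d)$ random vectors, let $\bar x_i=(1,x_i^\top)^\top\in\mathbb{R}^{d+1}$, let $\bar\beta=(\beta_0,\beta^\top)^\top$ with $\beta\in\mathbb{R}^d$ such that $\mathrm{Var}(x_i\cdot\beta)=\gamma_0^2$ for all $i$, and let $y_1,\dots,y_n$ be $\{-1,1\}$-valued random variables that are conditionally independent given $(x_1,\dots,x_n)$ with $\mathbb{P}(y_i=1\mid x_1,\dots,x_n)=\Phi(\bar x_i\cdot\bar\beta)$ almost surely for every $i$. Let $l(\theta)=-\sum_{i=1}^n\ln\Phi(y_i\,\bar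 x_i\cdot\theta)$ for $\theta\in\mathbb{R}^{d+1}$, with Hessian $H=D^2l$, and let $$L=\sup_{\theta\in\mathbb{R}^{d+1}}\lambda_{\max}(H(\theta)),\qquad m=\inf_{\theta\in\mathbb{R}^{d+1}}\lambda_{\min}(H(\theta)),$$ where $\lambda_{\max},\lambda_{\min}$ are the largest and smallest eigenvalue. Then $\{L/m<\infty\}$ (with $L/m:=\infty$ if $m=0$) is an event, up to null sets, and $$\mathbb{P}(L/m<\infty)\ \ge\ 1-\exp(-cn).$$ -/

import Mathlib

open MeasureTheory ProbabilityTheory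

noncomputable section

namespace Probit

/-- The cumulative distribution function of the standard normal distribution. -/
def Phi (z : ℝ) : ℝ := cdf (gaussianReal 0 1) z

/-- The vector `(a, v₁, …, v_d)` of `ℝ^{d+1}`. -/
def consVec {d : ℕ} (a : ℝ) (v : EuclideanSpace ℝ (Fin d)) : EuclideanSpace ℝ (Fin (d + 1)) :=
  WithLp.toLp 2 (Fin.cons a (fun j => v j))

/-- The negative log-likelihood `l(θ) = - ∑ᵢ ln Φ(yᵢ x̄ᵢ ⬝ θ)` of probit regression. -/
def negLogLik {n p : ℕ} (xbar : Fin n → EuclideanSpace ℝ (Fin p)) (y : Fin n → ℝ)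
    (θ : EuclideanSpace ℝ (Fin p)) : ℝ :=
  -∑ i, Real.log (Phi (y i * inner ℝ (xbar i) θ))

/-- The Hessian matrix `D²f(θ)` of second partial derivatives. -/
def hessian {p : ℕ} (f : EuclideanSpace ℝ (Fin p) → ℝ) (θ : EuclideanSpace ℝ (Fin p)) :
    Matrix (Fin p) (Fin p) ℝ :=
  Matrix.of fun i j =>
    fderiv ℝ (fderiv ℝ f) θ (EuclideanSpace.single i 1) (EuclideanSpace.single j 1)

/-- The largest (real) eigenvalue of a square matrix. -/
def lambdaMax {p : ℕ} (A : Matrix (Fin p) (Fin p) ℝ) : ℝ := sSup (spectrum ℝ A)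

/-- The smallest (real) eigenvalue of a square matrix. -/
def lambdaMin {p : ℕ} (A : Matrix (Fin p) (Fin p) ℝ) : ℝ := sInf (spectrum ℝ A)

/-- `L = sup_θ λ_max(D²l(θ))`, as an element of `[0, ∞]` (`l` is convex, so that no eigenvalue is
negative). -/
def supEig {n p : ℕ} (xbar : Fin n → EuclideanSpace ℝ (Fin p)) (y : Fin n → ℝ) : ENNReal :=
  ⨆ θ, ENNReal.ofReal (lambdaMax (hessian (negLogLik xbar y) θ))

/-- `m = inf_θ λ_min(D²l(θ))`, as an element of `[0, ∞]`. -/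
def infEig {n p : ℕ} (xbar : Fin n → EuclideanSpace ℝ (Fin p)) (y : Fin n → ℝ) : ENNReal :=
  ⨅ θ, ENNReal.ofReal (lambdaMin (hessian (negLogLik xbar y) θ))

open Classical in
/-- The condition number `L / m`, which is infinite if `m = 0`. -/
def condNumber {n p : ℕ} (xbar : Fin n → EuclideanSpace ℝ (Fin p)) (y : Fin n → ℝ) : ENNReal :=
  if infEig xbar y = 0 then ⊤ else supEig xbar y / infEig xbar y

/-- Conditional independence of finitely many real random variables given a σ-algebra `m`. -/
def CondIndependent {Ω : Type*} [mΩ : MeasurableSpace Ω] (μ : Measure Ω) (m : MeasurableSpace Ω)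
    {n : ℕ} (y : Fin n → Ω → ℝ) : Prop :=
  ∀ B : Fin n → Set ℝ, (∀ i, MeasurableSet (B i)) →
    μ⟦⋂ i, y i ⁻¹' B i | m⟧ =ᵐ[μ] fun ω => ∏ i, (μ⟦y i ⁻¹' B i | m⟧) ω

/-- The σ-algebra generated by all the covariates. -/
abbrev covariateSigma {Ω : Type*} {n d : ℕ} (x : Fin n → Ω → EuclideanSpace ℝ (Fin d)) :
    MeasurableSpace Ω :=
  MeasurableSpace.comap (fun ω i => x i ω) inferInstance

/-- The well-specified probit model with intercept and standard Gaussian design: the covariates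
`xᵢ` are i.i.d. with law `N(0, I_d)` and, given all the covariates, the responses `yᵢ ∈ {-1, 1}`
are independent and `yᵢ = 1` has conditional probability `Φ(x̄ᵢ ⬝ β̄)`,
where `x̄ᵢ = (1, xᵢ)` and `β̄ = (β₀, β)`. -/
structure GaussianProbitModel {Ω : Type*} [MeasurableSpace Ω] (μ : Measure Ω) {n d : ℕ}
    (x : Fin n → Ω → EuclideanSpace ℝ (Fin d)) (y : Fin n → Ω → ℝ)
    (β₀ : ℝ) (β : EuclideanSpace ℝ (Fin d)) : Prop where
  measurable_x : ∀ i, Measurable (x i)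
  measurable_y : ∀ i, Measurable (y i)
  y_mem : ∀ i ω, y i ω = -1 ∨ y i ω = 1
  indep_x : iIndepFun x μ
  law_x : ∀ i, μ.map (x i) = stdGaussian (EuclideanSpace ℝ (Fin d))
  condIndep_y : CondIndependent μ (covariateSigma x) y
  condLaw_y : ∀ i, μ⟦y i ⁻¹' {1} | covariateSigma x⟧ =ᵐ[μ]
    fun ω => Phi (inner ℝ (consVec 1 (x i ω)) (consVec β₀ β))

/-- `h = 𝔼[Φ(-|β₀ + γ₀ Z|)]` for `Z ∼ N(0, 1)`. -/
def hConst (β₀ γ₀ : ℝ) : ℝ := ∫ z, Phi (-|β₀ + γ₀ * z|) ∂(gaussianReal 0 1)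

end Probit

end

/-!
The function `g = -ln Φ` has second derivative `R (z + R)` with `R = φ / Φ`. It is bounded, stays
away from `0` on `(-∞, 0]` (by the bounds for Mills' ratio) and tends to `0` at `+∞`. Hence `L` is
always finite, and `L / m` is finite if and only if `m > 0`. The Hessian at `θ` is
`∑ᵢ g''(zᵢ ⬝ θ) zᵢ zᵢᵀ` with `zᵢ = yᵢ x̄ᵢ`, and its smallest eigenvalue is controlled by the points
with `zᵢ ⬝ θ ≤ 0`. If fewer than `d + 1` points satisfy this for some `θ`, then the smallest
eigenvalue tends to `0` along the ray through `θ`; if at least `d + 1` do for every `θ`, and any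
`d + 1` points span, then `m > 0`. Since Gaussian covariates are almost surely in general position,
`L / m < ∞` holds almost surely exactly if every `θ`, as a classifier, makes at least `d + 1`
errors `zᵢ ⬝ θ ≤ 0` (`condNumber_lt_top_ae_eq`). This also gives measurability, because `θ` may be
restricted to a countable dense set.

The probability that some classifier makes at most `d` errors is at most a product of two factors.
* Given the covariates, half-spaces produce at most `exp (n s ln (e / s))` labellings, where
  `(d + 1) / n ≤ s` (Sauer–Shelah, `card_halfspaces_le`).
* For a single labelling, the conditional Laplace transform at `a ≥ 0` of the number of errors is at
  most that of the Bayes classifier, `∏ᵢ (1 - (1 - e⁻ᵃ) Φ(-|x̄ᵢ ⬝ β̄|))`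
  (`sum_labelProb_le`), whose mean over the independent covariates is `(1 - (1 - e⁻ᵃ) h)ⁿ`.

With `a = h - s` the exponential Markov inequality yields the bound `exp (-c n)` for
`c = (h - s)² / 2 - s ln (e / s)` (`measureReal_fewErrors_le_exp`), and `c` is positive precisely
because `s` is smaller than the solution of the threshold equation.
-/

open MeasureTheory ProbabilityTheory

noncomputable section

open Filter Topology

namespace Probit

/-! ### The curvature of the probit link -/

/-- The standard normal density. -/
def phi (z : ℝ) : ℝ := gaussianPDFReal 0 1 z

lemma phi_eq (z : ℝ) : phi z = (√(2 * Real.pi))⁻¹ * Real.exp (-z ^ 2 / 2) := by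
  simp [phi, gaussianPDFReal]

lemma phi_pos (z : ℝ) : 0 < phi z := gaussianPDFReal_pos _ _ _ one_ne_zero

lemma hasDerivAt_phi (z : ℝ) : HasDerivAt phi (-z * phi z) z := by
  have h : HasDerivAt (fun z : ℝ => -z ^ 2 / 2) (-z) z := by
    have := ((hasDerivAt_pow 2 z).neg).div_const 2
    exact this.congr_deriv (by norm_num; ring)
  have h2 := (h.exp).const_mul (√(2 * Real.pi))⁻¹
  have e : phi = fun z => (√(2 * Real.pi))⁻¹ * Real.exp (-z ^ 2 / 2) := funext phi_eq
  rw [e]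
  exact h2.congr_deriv (by ring)

lemma continuous_phi : Continuous phi :=
  continuous_iff_continuousAt.2 fun z => (hasDerivAt_phi z).continuousAt

lemma phi_neg (z : ℝ) : phi (-z) = phi z := by simp [phi_eq]

lemma Phi_eq_integral (z : ℝ) : Phi z = ∫ t in Set.Iic z, phi t := by
  rw [Phi, cdf_eq_real, Measure.real, gaussianReal_apply_eq_integral _ one_ne_zero,
    ENNReal.toReal_ofReal]
  · rfl
  · exact integral_nonneg fun t => gaussianPDFReal_nonneg _ _ _

lemma integrable_phi : Integrable phi := integrable_gaussianPDFReal 0 1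

lemma hasDerivAt_Phi (z : ℝ) : HasDerivAt Phi (phi z) z := by
  have e : Phi = fun z => Phi 0 + ∫ t in (0 : ℝ)..z, phi t := by
    funext w
    rw [intervalIntegral.integral_Iic_sub_Iic integrable_phi.integrableOn
      integrable_phi.integrableOn |>.symm, ← Phi_eq_integral, ← Phi_eq_integral]
    ring
  rw [e]
  exact (intervalIntegral.integral_hasDerivAt_right
    (continuous_phi.intervalIntegrable _ _)
    continuous_phi.stronglyMeasurable.stronglyMeasurableAtFilter
    continuous_phi.continuousAt).const_add _

lemma continuous_Phi : Continuous Phi :=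
  continuous_iff_continuousAt.2 fun z => (hasDerivAt_Phi z).continuousAt

lemma strictMono_Phi : StrictMono Phi :=
  strictMono_of_deriv_pos fun z => by rw [(hasDerivAt_Phi z).deriv]; exact phi_pos z

lemma Phi_nonneg (z : ℝ) : 0 ≤ Phi z := cdf_nonneg _ _

lemma Phi_le_one (z : ℝ) : Phi z ≤ 1 := cdf_le_one _ _

lemma Phi_pos (z : ℝ) : 0 < Phi z :=
  (Phi_nonneg (z - 1)).trans_lt (strictMono_Phi (by linarith))

lemma tendsto_Phi_atTop : Tendsto Phi atTop (𝓝 1) := tendsto_cdf_atTop _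

lemma tendsto_Phi_atBot : Tendsto Phi atBot (𝓝 0) := tendsto_cdf_atBot _

lemma Phi_neg (z : ℝ) : Phi (-z) = 1 - Phi z := by
  have hd : ∀ w, HasDerivAt (fun w => Phi w + Phi (-w)) 0 w := fun w => by
    have h := (hasDerivAt_Phi w).add ((hasDerivAt_Phi (-w)).comp w (hasDerivAt_neg w))
    exact h.congr_deriv (by rw [phi_neg]; ring)
  have hconst : ∀ w, Phi w + Phi (-w) = Phi z + Phi (-z) := fun w =>
    is_const_of_deriv_eq_zero (fun v => (hd v).differentiableAt) (fun v => (hd v).deriv) w z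
  have hlim : Tendsto (fun w => Phi w + Phi (-w)) atTop (𝓝 (1 + 0)) :=
    tendsto_Phi_atTop.add (tendsto_Phi_atBot.comp tendsto_neg_atTop_atBot)
  have := tendsto_nhds_unique (tendsto_const_nhds.congr fun w => (hconst w).symm) hlim
  linarith

lemma tendsto_id_mul_phi_atTop : Tendsto (fun z => z * phi z) atTop (𝓝 0) := by
  have h := tendsto_rpow_abs_mul_exp_neg_mul_sq_cocompact (a := 1 / 2) (by norm_num) 1
  have h2 := (h.mono_left atTop_le_cocompact).const_mul (√(2 * Real.pi))⁻¹
  rw [mul_zero] at h2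
  refine h2.congr' ?_
  filter_upwards [eventually_ge_atTop 0] with z hz
  rw [phi_eq, abs_of_nonneg hz, Real.rpow_one]
  rw [show -(1 / 2) * z ^ 2 = -z ^ 2 / 2 by ring]; ring

lemma tendsto_phi_atTop : Tendsto phi atTop (𝓝 0) := by
  refine squeeze_zero' (Eventually.of_forall fun z => (phi_pos z).le) ?_ tendsto_id_mul_phi_atTop
  filter_upwards [eventually_ge_atTop 1] with z hz
  nlinarith [phi_pos z]

/-- The ratio `φ / Φ`, the derivative of `ln Φ`. -/
def hazard (z : ℝ) : ℝ := phi z / Phi z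

/-- The second derivative of `-ln Φ`. -/
def curv (z : ℝ) : ℝ := hazard z * (z + hazard z)

lemma hazard_pos (z : ℝ) : 0 < hazard z := div_pos (phi_pos z) (Phi_pos z)

lemma hasDerivAt_neg_log_Phi (z : ℝ) :
    HasDerivAt (fun z => -Real.log (Phi z)) (-hazard z) z :=
  ((hasDerivAt_Phi z).log (Phi_pos z).ne').neg

lemma hasDerivAt_neg_hazard (z : ℝ) : HasDerivAt (fun z => -hazard z) (curv z) z := by
  have h := ((hasDerivAt_phi z).div (hasDerivAt_Phi z) (Phi_pos z).ne').neg
  refine h.congr_deriv ?_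
  have := (Phi_pos z).ne'
  rw [curv, hazard]
  field_simp
  ring

lemma continuous_hazard : Continuous hazard :=
  continuous_phi.div continuous_Phi fun z => (Phi_pos z).ne'

lemma continuous_curv : Continuous curv :=
  continuous_hazard.mul (continuous_id.add continuous_hazard)

lemma tendsto_hazard_atTop : Tendsto hazard atTop (𝓝 0) := by
  have := tendsto_phi_atTop.div tendsto_Phi_atTop one_ne_zero
  rwa [zero_div] at this

lemma tendsto_curv_atTop : Tendsto curv atTop (𝓝 0) := by
  have h1 := tendsto_id_mul_phi_atTop.div tendsto_Phi_atTop one_ne_zero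
  have h2 := h1.add (tendsto_hazard_atTop.mul tendsto_hazard_atTop)
  rw [zero_div, mul_zero, add_zero] at h2
  refine h2.congr fun z => ?_
  simp only [Pi.div_apply, curv, hazard]
  ring

lemma hasDerivAt_mul_phi_sub_tail {a : ℝ → ℝ} {a' s : ℝ} (ha : HasDerivAt a a' s) :
    HasDerivAt (fun s => a s * phi s - Phi (-s)) ((a' - s * a s + 1) * phi s) s := by
  have h := (ha.mul (hasDerivAt_phi s)).sub ((hasDerivAt_Phi (-s)).comp s (hasDerivAt_neg s))
  exact h.congr_deriv (by rw [phi_neg]; ring)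

/-- A comparison principle for Mills' ratio: if `(a t φ(t))' ≤ -φ(t)` on `(0, ∞)` and `a φ`
vanishes at infinity, then `a φ` dominates the Gaussian tail there. -/
lemma tail_le_of_deriv {a a' : ℝ → ℝ} (ha : ∀ t, 0 < t → HasDerivAt a (a' t) t)
    (hle : ∀ t, 0 < t → a' t - t * a t + 1 ≤ 0)
    (hlim : Tendsto (fun t => a t * phi t) atTop (𝓝 0)) {t : ℝ} (ht : 0 < t) :
    Phi (-t) ≤ a t * phi t := by
  have hd := fun s (hs : 0 < s) => hasDerivAt_mul_phi_sub_tail (ha s hs)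
  have hanti : AntitoneOn (fun s => a s * phi s - Phi (-s)) (Set.Ioi 0) := by
    refine antitoneOn_of_deriv_nonpos (convex_Ioi 0)
      (fun s hs => (hd s hs).continuousAt.continuousWithinAt)
      (fun s hs => ((hd s (by simpa using hs)).differentiableAt).differentiableWithinAt) ?_
    intro s hs
    rw [interior_Ioi] at hs
    rw [(hd s hs).deriv]
    exact mul_nonpos_of_nonpos_of_nonneg (hle s hs) (phi_pos s).le
  have hl : Tendsto (fun s => a s * phi s - Phi (-s)) atTop (𝓝 (0 - 0)) :=
    hlim.sub (tendsto_Phi_atBot.comp tendsto_neg_atTop_atBot)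
  rw [sub_zero] at hl
  have := le_of_tendsto hl (by
    filter_upwards [eventually_ge_atTop t] with s hs
    exact hanti ht (ht.trans_le hs) hs)
  linarith

/-- The reverse comparison: if `(a t φ(t))' ≥ -φ(t)` on `(0, ∞)` and `a φ` vanishes at infinity,
then the Gaussian tail dominates `a φ` there. -/
lemma le_tail_of_deriv {a a' : ℝ → ℝ} (ha : ∀ t, 0 < t → HasDerivAt a (a' t) t)
    (hle : ∀ t, 0 < t → 0 ≤ a' t - t * a t + 1)
    (hlim : Tendsto (fun t => a t * phi t) atTop (𝓝 0)) {t : ℝ} (ht : 0 < t) :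
    a t * phi t ≤ Phi (-t) := by
  have hd := fun s (hs : 0 < s) => hasDerivAt_mul_phi_sub_tail (ha s hs)
  have hmono : MonotoneOn (fun s => a s * phi s - Phi (-s)) (Set.Ioi 0) := by
    refine monotoneOn_of_deriv_nonneg (convex_Ioi 0)
      (fun s hs => (hd s hs).continuousAt.continuousWithinAt)
      (fun s hs => ((hd s (by simpa using hs)).differentiableAt).differentiableWithinAt) ?_
    intro s hs
    rw [interior_Ioi] at hs
    rw [(hd s hs).deriv]
    exact mul_nonneg (hle s hs) (phi_pos s).le
  have hl : Tendsto (fun s => a s * phi s - Phi (-s)) atTop (𝓝 (0 - 0)) :=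
    hlim.sub (tendsto_Phi_atBot.comp tendsto_neg_atTop_atBot)
  rw [sub_zero] at hl
  have := ge_of_tendsto hl (by
    filter_upwards [eventually_ge_atTop t] with s hs
    exact hmono ht (ht.trans_le hs) hs)
  linarith

/-- A convergent of Laplace's continued fraction for Mills' ratio, of high enough order for the
lower bound on the curvature near `-∞`: the simpler bound `φ(t) / t` only gives `curv (-t) ≥ 0`. -/
lemma tail_upper {t : ℝ} (ht : 0 < t) :
    Phi (-t) ≤ (t ^ 2 + 2) / (t ^ 3 + 3 * t) * phi t := by
  refine tail_le_of_deriv (a := fun t => (t ^ 2 + 2) / (t ^ 3 + 3 * t))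
    (a' := fun t => (2 * t * (t ^ 3 + 3 * t) - (t ^ 2 + 2) * (3 * t ^ 2 + 3)) /
      (t ^ 3 + 3 * t) ^ 2) ?_ ?_ ?_ ht
  · intro t ht
    have h1 : HasDerivAt (fun t : ℝ => t ^ 2 + 2) (2 * t) t := by
      simpa using (hasDerivAt_pow 2 t).add_const 2
    have h2 : HasDerivAt (fun t : ℝ => t ^ 3 + 3 * t) (3 * t ^ 2 + 3) t := by
      exact ((hasDerivAt_pow 3 t).add ((hasDerivAt_id t).const_mul 3)).congr_deriv (by simp)
    exact h1.div h2 (by positivity)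
  · intro t ht
    have : (2 * t * (t ^ 3 + 3 * t) - (t ^ 2 + 2) * (3 * t ^ 2 + 3)) /
      (t ^ 3 + 3 * t) ^ 2 - t * ((t ^ 2 + 2) / (t ^ 3 + 3 * t)) + 1
        = -6 / (t ^ 3 + 3 * t) ^ 2 := by
      field_simp
      ring
    rw [this]
    exact div_nonpos_of_nonpos_of_nonneg (by norm_num) (by positivity)
  · refine squeeze_zero' ?_ ?_ tendsto_phi_atTop
    · filter_upwards [eventually_gt_atTop 0] with t ht
      exact mul_nonneg (by positivity) (phi_pos t).le
    · filter_upwards [eventually_ge_atTop 1] with t ht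
      have : (t ^ 2 + 2) / (t ^ 3 + 3 * t) ≤ 1 := by
        rw [div_le_one (by positivity)]
        nlinarith [pow_le_pow_right₀ ht (show 2 ≤ 3 by norm_num)]
      nlinarith [phi_pos t]

lemma tail_lower {t : ℝ} (ht : 0 < t) : t / (t ^ 2 + 1) * phi t ≤ Phi (-t) := by
  refine le_tail_of_deriv (a := fun t => t / (t ^ 2 + 1))
    (a' := fun t => (1 * (t ^ 2 + 1) - t * (2 * t)) / (t ^ 2 + 1) ^ 2) ?_ ?_ ?_ ht
  · intro t ht
    have h2 : HasDerivAt (fun t : ℝ => t ^ 2 + 1) (2 * t) t := by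
      simpa using (hasDerivAt_pow 2 t).add_const 1
    exact (hasDerivAt_id t).div h2 (by positivity)
  · intro t ht
    have : (1 * (t ^ 2 + 1) - t * (2 * t)) / (t ^ 2 + 1) ^ 2 - t * (t / (t ^ 2 + 1)) + 1
        = 2 / (t ^ 2 + 1) ^ 2 := by
      field_simp
      ring
    rw [this]
    positivity
  · refine squeeze_zero' ?_ ?_ tendsto_phi_atTop
    · filter_upwards [eventually_gt_atTop 0] with t ht
      exact mul_nonneg (by positivity) (phi_pos t).le
    · filter_upwards [eventually_ge_atTop 1] with t ht
      have : t / (t ^ 2 + 1) ≤ 1 := by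
        rw [div_le_one (by positivity)]
        nlinarith
      nlinarith [phi_pos t]

lemma hazard_neg_lower {t : ℝ} (ht : 0 < t) : t + t / (t ^ 2 + 2) ≤ hazard (-t) := by
  rw [hazard, phi_neg, le_div_iff₀ (Phi_pos _)]
  calc (t + t / (t ^ 2 + 2)) * Phi (-t)
      ≤ (t + t / (t ^ 2 + 2)) * ((t ^ 2 + 2) / (t ^ 3 + 3 * t) * phi t) :=
        mul_le_mul_of_nonneg_left (tail_upper ht) (by positivity)
    _ = phi t := by field_simp; ring

lemma hazard_neg_upper {t : ℝ} (ht : 0 < t) : hazard (-t) ≤ t + 1 / t := by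
  rw [hazard, phi_neg, div_le_iff₀ (Phi_pos _)]
  calc phi t = (t + 1 / t) * (t / (t ^ 2 + 1) * phi t) := by field_simp
    _ ≤ (t + 1 / t) * Phi (-t) := mul_le_mul_of_nonneg_left (tail_lower ht) (by positivity)

lemma curv_pos (z : ℝ) : 0 < curv z := by
  refine mul_pos (hazard_pos z) ?_
  rcases le_or_gt 0 z with hz | hz
  · have := hazard_pos z; linarith
  · have h := hazard_neg_lower (t := -z) (by linarith)
    have h2 : 0 < -z / ((-z) ^ 2 + 2) := div_pos (by linarith) (by positivity)
    rw [neg_neg] at h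
    linarith

/-- The curvature of `-ln Φ` is bounded below on the negative half-line. -/
lemma exists_curv_lower : ∃ c > 0, ∀ z ≤ 0, c ≤ curv z := by
  obtain ⟨z₀, -, hz₀⟩ := isCompact_Icc.exists_isMinOn
    (Set.nonempty_Icc.2 (by norm_num : (-1 : ℝ) ≤ 0))
    continuous_curv.continuousOn
  refine ⟨min (curv z₀) (1 / 3), lt_min (curv_pos _) (by norm_num), fun z hz => ?_⟩
  rcases le_or_gt (-1) z with h1 | h1
  · exact (min_le_left _ _).trans (hz₀ ⟨h1, hz⟩)
  · refine (min_le_right _ _).trans ?_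
    obtain ⟨t, rfl⟩ : ∃ t, z = -t := ⟨-z, by ring⟩
    have ht : 1 < t := by linarith
    have h := hazard_neg_lower (t := t) (by linarith)
    have h3 : t * (t / (t ^ 2 + 2)) ≥ 1 / 3 := by
      rw [ge_iff_le, ← mul_div_assoc, div_le_div_iff₀ (by norm_num) (by positivity)]
      nlinarith
    have h4 : 0 ≤ t / (t ^ 2 + 2) := by positivity
    have h5 : t * (t / (t ^ 2 + 2)) ≤ hazard (-t) * (-t + hazard (-t)) :=
      mul_le_mul (by linarith) (by linarith) h4 (hazard_pos _).le
    rw [curv]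
    linarith

/-- The curvature of `-ln Φ` is bounded. -/
lemma exists_curv_upper : ∃ C : ℝ, ∀ z, curv z ≤ C := by
  obtain ⟨B, hB⟩ := (tendsto_curv_atTop.eventually_le_const one_pos).exists_forall_of_atTop
  obtain ⟨z₁, -, hz₁⟩ := isCompact_Icc.exists_isMaxOn
    (Set.nonempty_Icc.2 (by simp : (-1 : ℝ) ≤ max B 0))
    continuous_curv.continuousOn
  refine ⟨max (max (curv z₁) 1) 2, fun z => ?_⟩
  rcases lt_or_ge z (-1) with h1 | h1
  · refine le_max_of_le_right ?_
    obtain ⟨t, rfl⟩ : ∃ t, z = -t := ⟨-z, by ring⟩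
    have ht : 1 < t := by linarith
    have h := hazard_neg_upper (t := t) (by linarith)
    have h0 : 0 < 1 / t := by positivity
    have h2 : t * (1 / t) = 1 := by field_simp
    have h3 : 1 / t ≤ 1 := by rw [div_le_one (by linarith)]; linarith
    rw [curv]
    calc hazard (-t) * (-t + hazard (-t)) ≤ hazard (-t) * (1 / t) :=
          mul_le_mul_of_nonneg_left (by linarith) (hazard_pos _).le
      _ ≤ (t + 1 / t) * (1 / t) := mul_le_mul_of_nonneg_right h h0.le
      _ ≤ 2 := by nlinarith
  · refine le_max_of_le_left ?_
    rcases le_or_gt z (max B 0) with h2 | h2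
    · exact le_max_of_le_left (hz₁ ⟨h1, h2⟩)
    · exact le_max_of_le_right (hB z ((le_max_left _ _).trans h2.le))

/-! ### Extreme eigenvalues of symmetric matrices -/

section Eigenvalues

variable {p : ℕ} {A : Matrix (Fin p) (Fin p) ℝ}

lemma bddBelow_spectrum (hA : A.IsHermitian) : BddBelow (spectrum ℝ A) := by
  rw [hA.spectrum_real_eq_range_eigenvalues]
  exact (Set.finite_range _).bddBelow

lemma exists_unit_of_mem_spectrum (hA : A.IsHermitian) {a : ℝ} (ha : a ∈ spectrum ℝ A) :
    ∃ v : EuclideanSpace ℝ (Fin p), ‖v‖ = 1 ∧ v.ofLp ⬝ᵥ A.mulVec v.ofLp = a := by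
  rw [hA.spectrum_real_eq_range_eigenvalues] at ha
  obtain ⟨i, rfl⟩ := ha
  refine ⟨hA.eigenvectorBasis i, hA.eigenvectorBasis.norm_eq_one i, ?_⟩
  rw [hA.mulVec_eigenvectorBasis, dotProduct_smul]
  have h : (hA.eigenvectorBasis i).ofLp ⬝ᵥ (hA.eigenvectorBasis i).ofLp = 1 := by
    have h2 := EuclideanSpace.real_norm_sq_eq (hA.eigenvectorBasis i)
    rw [hA.eigenvectorBasis.norm_eq_one] at h2
    simpa [dotProduct, sq] using h2.symm
  rw [h, smul_eq_mul, mul_one]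

lemma spectrum_nonempty_of_isHermitian [NeZero p] (hA : A.IsHermitian) :
    (spectrum ℝ A).Nonempty := by
  rw [hA.spectrum_real_eq_range_eigenvalues]
  exact Set.range_nonempty _

lemma le_lambdaMin [NeZero p] (hA : A.IsHermitian) {c : ℝ}
    (h : ∀ v : EuclideanSpace ℝ (Fin p), c * ‖v‖ ^ 2 ≤ v.ofLp ⬝ᵥ A.mulVec v.ofLp) :
    c ≤ lambdaMin A := by
  refine le_csInf (spectrum_nonempty_of_isHermitian hA) fun a ha => ?_
  obtain ⟨v, hv, rfl⟩ := exists_unit_of_mem_spectrum hA ha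
  simpa [hv] using h v

lemma lambdaMax_le [NeZero p] (hA : A.IsHermitian) {c : ℝ}
    (h : ∀ v : EuclideanSpace ℝ (Fin p), v.ofLp ⬝ᵥ A.mulVec v.ofLp ≤ c * ‖v‖ ^ 2) :
    lambdaMax A ≤ c := by
  refine csSup_le (spectrum_nonempty_of_isHermitian hA) fun a ha => ?_
  obtain ⟨v, hv, rfl⟩ := exists_unit_of_mem_spectrum hA ha
  simpa [hv] using h v

lemma lambdaMin_mul_le (hA : A.IsHermitian) (v : EuclideanSpace ℝ (Fin p)) :
    lambdaMin A * ‖v‖ ^ 2 ≤ v.ofLp ⬝ᵥ A.mulVec v.ofLp := by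
  set c := lambdaMin A with hc
  have hB : (A - algebraMap ℝ _ c).IsHermitian := by
    refine hA.sub ?_
    rw [Matrix.algebraMap_eq_diagonal]
    exact Matrix.isHermitian_diagonal _
  have hpos : (A - algebraMap ℝ _ c).PosSemidef := by
    rw [hB.posSemidef_iff_eigenvalues_nonneg]
    intro i
    have hi : hB.eigenvalues i ∈ spectrum ℝ (A - algebraMap ℝ _ c) := by
      rw [hB.spectrum_real_eq_range_eigenvalues]
      exact Set.mem_range_self i
    rw [← spectrum.sub_singleton_eq] at hi
    obtain ⟨a, ha, b, rfl, hab⟩ := hi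
    have : lambdaMin A ≤ a := csInf_le (bddBelow_spectrum hA) ha
    simp only [Pi.zero_apply]
    rw [← hab]
    simpa [hc] using this
  have h := hpos.re_dotProduct_nonneg v.ofLp
  simp only [Matrix.sub_mulVec, dotProduct_sub, star_trivial, RCLike.re_to_real] at h
  have h2 : v.ofLp ⬝ᵥ (algebraMap ℝ (Matrix (Fin p) (Fin p) ℝ) c).mulVec v.ofLp
      = c * ‖v‖ ^ 2 := by
    rw [Algebra.algebraMap_eq_smul_one, Matrix.smul_mulVec, Matrix.one_mulVec, dotProduct_smul,
      EuclideanSpace.real_norm_sq_eq]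
    simp [dotProduct, sq]
  linarith

end Eigenvalues

/-! ### The Hessian of the negative log-likelihood -/

section Hessian

variable {n p : ℕ} (xbar : Fin n → EuclideanSpace ℝ (Fin p)) (y : Fin n → ℝ)

lemma negLogLik_eq : negLogLik xbar y =
    fun θ => ∑ k, -Real.log (Phi (inner ℝ (y k • xbar k) θ)) := by
  funext θ
  simp [negLogLik, real_inner_smul_left]

lemma hasFDerivAt_comp_inner {g : ℝ → ℝ} {g' : ℝ} (z θ : EuclideanSpace ℝ (Fin p))
    (hg : HasDerivAt g g' (inner ℝ z θ)) :
    HasFDerivAt (fun θ => g (inner ℝ z θ)) (g' • innerSL ℝ z) θ :=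
  hg.comp_hasFDerivAt θ (innerSL ℝ z).hasFDerivAt

lemma fderiv_negLogLik : fderiv ℝ (negLogLik xbar y) =
    fun θ => ∑ k, (-hazard (inner ℝ (y k • xbar k) θ)) • innerSL ℝ (y k • xbar k) := by
  funext θ
  rw [negLogLik_eq]
  exact (HasFDerivAt.fun_sum fun k _ =>
    hasFDerivAt_comp_inner (y k • xbar k) θ (hasDerivAt_neg_log_Phi _)).fderiv

lemma hessian_negLogLik (θ : EuclideanSpace ℝ (Fin p)) : hessian (negLogLik xbar y) θ =
    Matrix.of fun i j => ∑ k, curv (inner ℝ (y k • xbar k) θ) *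
      ((y k • xbar k) i * (y k • xbar k) j) := by
  have h : fderiv ℝ (fderiv ℝ (negLogLik xbar y)) θ =
      ∑ k, (curv (inner ℝ (y k • xbar k) θ) • innerSL ℝ (y k • xbar k)).smulRight
        (innerSL ℝ (y k • xbar k)) := by
    rw [fderiv_negLogLik]
    refine (HasFDerivAt.fun_sum fun k _ => ?_).fderiv
    exact (hasFDerivAt_comp_inner (y k • xbar k) θ (hasDerivAt_neg_hazard _)).smul_const
      (innerSL ℝ (y k • xbar k))
  ext i j
  simp only [hessian, Matrix.of_apply, h]
  simp [mul_assoc, EuclideanSpace.inner_single_right]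

lemma isHermitian_hessian (θ : EuclideanSpace ℝ (Fin p)) :
    (hessian (negLogLik xbar y) θ).IsHermitian := by
  rw [hessian_negLogLik]
  ext i j
  simp only [Matrix.conjTranspose_apply, Matrix.of_apply, star_trivial]
  exact Finset.sum_congr rfl fun k _ => by ring

lemma quadForm_hessian (θ v : EuclideanSpace ℝ (Fin p)) :
    v.ofLp ⬝ᵥ (hessian (negLogLik xbar y) θ).mulVec v.ofLp =
      ∑ k, curv (inner ℝ (y k • xbar k) θ) * inner ℝ (y k • xbar k) v ^ 2 := by
  have hin : ∀ z : EuclideanSpace ℝ (Fin p), inner ℝ z v = ∑ i, z i * v i := fun z => by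
    simp [PiLp.inner_apply, mul_comm]
  simp only [hessian_negLogLik, dotProduct, Matrix.mulVec, Matrix.of_apply, Finset.sum_mul,
    Finset.mul_sum]
  simp_rw [hin, sq, Finset.sum_mul_sum, Finset.mul_sum]
  rw [Finset.sum_congr rfl fun i _ => Finset.sum_comm, Finset.sum_comm]
  exact Finset.sum_congr rfl fun k _ => Finset.sum_congr rfl fun i _ =>
    Finset.sum_congr rfl fun j _ => by ring

end Hessian

/-! ### When the condition number is finite -/

section CondNumber

variable {n p : ℕ} (xbar : Fin n → EuclideanSpace ℝ (Fin p)) (y : Fin n → ℝ)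

lemma supEig_lt_top [NeZero p] : supEig xbar y < ⊤ := by
  obtain ⟨C, hC⟩ := exists_curv_upper
  refine lt_of_le_of_lt (iSup_le fun θ => ENNReal.ofReal_le_ofReal
    (lambdaMax_le (c := ∑ k, C * ‖y k • xbar k‖ ^ 2) (isHermitian_hessian xbar y θ)
      fun v => ?_)) ENNReal.ofReal_lt_top
  rw [quadForm_hessian, Finset.sum_mul]
  refine Finset.sum_le_sum fun k _ => ?_
  rw [mul_assoc, ← mul_pow]
  exact mul_le_mul (hC _) (sq_le_sq' (neg_le_of_abs_le (abs_real_inner_le_norm _ _))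
    (real_inner_le_norm _ _)) (sq_nonneg _) ((curv_pos 0).le.trans (hC 0))

/-- Let fewer than `p` of the signed covariates have nonpositive inner product with some `θ`. Some
unit direction is orthogonal to all of these, and along the ray `t θ` the curvature contributed by
all others vanishes in the limit. -/
lemma infEig_eq_zero (θ : EuclideanSpace ℝ (Fin p))
    (h : (Finset.univ.filter fun i => inner ℝ (y i • xbar i) θ ≤ 0).card < p) :
    infEig xbar y = 0 := by
  set z := fun i => y i • xbar i with hz
  set S := Finset.univ.filter fun i => inner ℝ (z i) θ ≤ 0 with hS
  obtain ⟨v, hv, hv0⟩ : ∃ v ∈ (Submodule.span ℝ (z '' S))ᗮ, v ≠ 0 := by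
    rw [← Submodule.ne_bot_iff, Ne, Submodule.orthogonal_eq_bot_iff]
    intro htop
    have h1 : Module.finrank ℝ (Submodule.span ℝ (z '' S)) ≤ S.card := by
      classical
      have := finrank_span_finset_le_card (R := ℝ) (S.image z)
      rw [Finset.coe_image] at this
      exact this.trans Finset.card_image_le
    rw [htop, finrank_top, finrank_euclideanSpace_fin] at h1
    omega
  have horth : ∀ i ∈ S, inner ℝ (z i) v = 0 := fun i hi =>
    (Submodule.mem_orthogonal _ _).1 hv _ (Submodule.subset_span ⟨i, hi, rfl⟩)
  have hlim : Tendsto (fun t : ℝ => (∑ k, curv (inner ℝ (z k) (t • θ)) * inner ℝ (z k) v ^ 2)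
      / ‖v‖ ^ 2) atTop (𝓝 0) := by
    have : Tendsto (fun t : ℝ => ∑ k, curv (inner ℝ (z k) (t • θ)) * inner ℝ (z k) v ^ 2)
        atTop (𝓝 (∑ k : Fin n, 0)) := by
      refine tendsto_finsetSum _ fun k _ => ?_
      by_cases hk : k ∈ S
      · simp [horth k hk]
      · have hk' : 0 < inner ℝ (z k) θ := by simpa [hS] using hk
        have h1 : Tendsto (fun t : ℝ => inner ℝ (z k) (t • θ)) atTop atTop := by
          simp_rw [real_inner_smul_right]
          exact tendsto_id.atTop_mul_const hk'
        simpa using (tendsto_curv_atTop.comp h1).mul_const (inner ℝ (z k) v ^ 2)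
    simpa using this.div_const (‖v‖ ^ 2)
  refine le_antisymm ?_ zero_le
  have h2 := ENNReal.tendsto_ofReal hlim
  rw [ENNReal.ofReal_zero] at h2
  refine ge_of_tendsto' h2 fun t => (iInf_le _ (t • θ)).trans (ENNReal.ofReal_le_ofReal ?_)
  rw [le_div_iff₀ (by positivity)]
  have := lambdaMin_mul_le (isHermitian_hessian xbar y (t • θ)) v
  rwa [quadForm_hessian] at this

lemma exists_lower_bound_sum_sq {ι : Type*} (z : ι → EuclideanSpace ℝ (Fin p)) (S : Finset ι)
    (hS : ∀ v, (∀ i ∈ S, inner ℝ (z i) v = 0) → v = 0) :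
    ∃ c > 0, ∀ v, c * ‖v‖ ^ 2 ≤ ∑ i ∈ S, inner ℝ (z i) v ^ 2 := by
  rcases (Metric.sphere (0 : EuclideanSpace ℝ (Fin p)) 1).eq_empty_or_nonempty with he | hne
  · refine ⟨1, one_pos, fun v => ?_⟩
    have : v = 0 := by
      by_contra hv
      have : ‖v‖⁻¹ • v ∈ Metric.sphere (0 : EuclideanSpace ℝ (Fin p)) 1 := by
        simp [norm_smul, hv]
      simp [he] at this
    simp [this]
  · obtain ⟨u, hu, hmin⟩ := (isCompact_sphere (0 : EuclideanSpace ℝ (Fin p)) 1).exists_isMinOn hne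
      (f := fun v => ∑ i ∈ S, inner ℝ (z i) v ^ 2) (by fun_prop)
    have hnn : 0 ≤ ∑ i ∈ S, inner ℝ (z i) u ^ 2 := Finset.sum_nonneg fun i _ => sq_nonneg _
    refine ⟨∑ i ∈ S, inner ℝ (z i) u ^ 2, lt_of_le_of_ne hnn fun h0 => ?_, fun v => ?_⟩
    · have := hS u fun i hi => by
        have := (Finset.sum_eq_zero_iff_of_nonneg fun i _ => sq_nonneg (inner ℝ (z i) u)).1
          h0.symm i hi
        simpa using this
      simp [this] at hu
    · by_cases hv : v = 0
      · simp [hv]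
      · have h1 : ‖v‖⁻¹ • v ∈ Metric.sphere (0 : EuclideanSpace ℝ (Fin p)) 1 := by
          simp [norm_smul, hv]
        have h2 : ∑ i ∈ S, inner ℝ (z i) u ^ 2 ≤ ∑ i ∈ S, inner ℝ (z i) (‖v‖⁻¹ • v) ^ 2 :=
          hmin h1
        simp_rw [real_inner_smul_right, mul_pow, ← Finset.mul_sum, inv_pow] at h2
        have hv' : 0 < ‖v‖ ^ 2 := by positivity
        rwa [inv_mul_eq_div, le_div_iff₀ hv'] at h2

/-- If any `p` signed covariates span the space, and every `θ` leaves at least `p` of them in the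
half-space of nonpositive inner product, then the Hessian is uniformly positive definite. -/
lemma infEig_ne_zero [NeZero p]
    (hspan : ∀ S : Finset (Fin n), p ≤ S.card →
      ∀ v, (∀ i ∈ S, inner ℝ (y i • xbar i) v = 0) → v = 0)
    (h : ∀ θ, p ≤ (Finset.univ.filter fun i => inner ℝ (y i • xbar i) θ ≤ 0).card) :
    infEig xbar y ≠ 0 := by
  obtain ⟨c, hc, hcurv⟩ := exists_curv_lower
  have hex : ∀ S : Finset (Fin n), ∃ a > 0, p ≤ S.card →
      ∀ v, a * ‖v‖ ^ 2 ≤ ∑ i ∈ S, inner ℝ (y i • xbar i) v ^ 2 := fun S => by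
    by_cases hS : p ≤ S.card
    · obtain ⟨a, ha, h⟩ := exists_lower_bound_sum_sq _ S (hspan S hS)
      exact ⟨a, ha, fun _ => h⟩
    · exact ⟨1, one_pos, fun h => absurd h hS⟩
  choose a ha hab using hex
  obtain ⟨S₀, -, hS₀⟩ := Finset.exists_min_image Finset.univ a Finset.univ_nonempty
  have hpos : 0 < c * a S₀ := mul_pos hc (ha _)
  refine ((ENNReal.ofReal_pos.2 hpos).trans_le (le_iInf fun θ =>
    ENNReal.ofReal_le_ofReal (le_lambdaMin (isHermitian_hessian xbar y θ) fun v => ?_))).ne'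
  rw [quadForm_hessian]
  set S := Finset.univ.filter fun i => inner ℝ (y i • xbar i) θ ≤ 0 with hS
  calc c * a S₀ * ‖v‖ ^ 2 ≤ c * (a S * ‖v‖ ^ 2) := by
        rw [mul_assoc]
        have := hS₀ S (Finset.mem_univ _)
        gcongr
    _ ≤ c * ∑ i ∈ S, inner ℝ (y i • xbar i) v ^ 2 :=
        mul_le_mul_of_nonneg_left (hab S (h θ) v) hc.le
    _ ≤ ∑ i ∈ S, curv (inner ℝ (y i • xbar i) θ) * inner ℝ (y i • xbar i) v ^ 2 := by
        rw [Finset.mul_sum]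
        refine Finset.sum_le_sum fun i hi => mul_le_mul_of_nonneg_right (hcurv _ ?_) (sq_nonneg _)
        simpa [hS] using hi
    _ ≤ _ := Finset.sum_le_sum_of_subset_of_nonneg (Finset.subset_univ _)
        fun i _ _ => mul_nonneg (curv_pos _).le (sq_nonneg _)

lemma condNumber_lt_top_iff [NeZero p] : condNumber xbar y < ⊤ ↔ infEig xbar y ≠ 0 := by
  unfold condNumber
  split_ifs with h
  · simp [h]
  · simp [h, ENNReal.div_lt_top (supEig_lt_top xbar y).ne h]

/-- In general position, `L / m` is finite if and only if every `θ` misclassifies (weakly) at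
least `p` of the data points. -/
lemma condNumber_lt_top_iff_forall_card [NeZero p]
    (hspan : ∀ S : Finset (Fin n), p ≤ S.card →
      ∀ v, (∀ i ∈ S, inner ℝ (y i • xbar i) v = 0) → v = 0) :
    condNumber xbar y < ⊤ ↔
      ∀ θ, p ≤ (Finset.univ.filter fun i => inner ℝ (y i • xbar i) θ ≤ 0).card := by
  rw [condNumber_lt_top_iff]
  refine ⟨fun h θ => ?_, infEig_ne_zero xbar y hspan⟩
  by_contra hθ
  exact h (infEig_eq_zero xbar y θ (not_le.1 hθ))

end CondNumber

/-! ### The number of half-space dichotomies -/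

/-- A family of subsets cut out by open half-spaces through the origin of `ℝ^p` shatters no set of
more than `p` points: by a linear dependence, the points with positive coefficients cannot be
separated from the remaining ones. -/
lemma vcDim_halfspaces_le {n p : ℕ} (x : Fin n → EuclideanSpace ℝ (Fin p))
    (𝒜 : Finset (Finset (Fin n))) (h𝒜 : ∀ A ∈ 𝒜, ∃ θ, ∀ i, i ∈ A ↔ 0 < inner ℝ (x i) θ) :
    𝒜.vcDim ≤ p := by
  refine Finset.sup_le fun S hS => ?_
  rw [Finset.mem_shatterer] at hS
  by_contra! hcard
  have hdep : ¬ LinearIndependent ℝ (fun i : S => x i) := fun hli => by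
    have := hli.fintype_card_le_finrank
    simp at this
    omega
  obtain ⟨g, hg, i₀, hi₀⟩ := Fintype.not_linearIndependent_iff.1 hdep
  -- Up to a sign change, some coefficient is positive.
  obtain ⟨a, ha, i, hi⟩ : ∃ a : S → ℝ, ∑ i, a i • x i = 0 ∧ ∃ i, 0 < a i := by
    rcases lt_or_gt_of_ne hi₀ with h | h
    · exact ⟨fun i => -g i, by simp only [neg_smul, Finset.sum_neg_distrib, hg, neg_zero], i₀,
        by simpa using h⟩
    · exact ⟨g, hg, i₀, h⟩
  set T : Finset (Fin n) := (Finset.univ.filter fun i : S => 0 < a i).map ⟨_, Subtype.val_injective⟩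
    with hT
  have hTmem : ∀ i : S, (i : Fin n) ∈ T ↔ 0 < a i := fun i => by simp [hT]
  have hTS : T ⊆ S := fun j hj => by
    simp only [hT, Finset.mem_map, Function.Embedding.coeFn_mk] at hj
    obtain ⟨i, -, rfl⟩ := hj
    exact i.2
  obtain ⟨A, hA, hAT⟩ := hS hTS
  obtain ⟨θ, hθ⟩ := h𝒜 A hA
  have hiff : ∀ i : S, 0 < a i ↔ 0 < inner ℝ (x i) θ := fun i => by
    rw [← hTmem, ← hθ, ← hAT]
    simp
  have hsum : ∑ i : S, a i * inner ℝ (x i) θ = 0 := by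
    have := congrArg (fun v => inner ℝ v θ) ha
    simpa [sum_inner, real_inner_smul_left] using this
  have hnn : ∀ i ∈ Finset.univ, 0 ≤ a i * inner ℝ (x i) θ := fun i _ => by
    by_cases h : 0 < a i
    · exact (mul_pos h ((hiff i).1 h)).le
    · exact mul_nonneg_of_nonpos_of_nonpos (not_lt.1 h) (not_lt.1 fun h' => h ((hiff i).2 h'))
  have := (Finset.sum_eq_zero_iff_of_nonneg hnn).1 hsum i (Finset.mem_univ _)
  exact (mul_pos hi ((hiff i).1 hi)).ne' this

lemma sum_choose_le_exp {n p : ℕ} (hp : 0 < p) (hpn : p ≤ n) :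
    (∑ k ∈ Finset.Iic p, (n.choose k : ℝ)) ≤
      Real.exp (n * (p / n * Real.log (Real.exp 1 / (p / n)))) := by
  have hn : (0 : ℝ) < n := by exact_mod_cast hp.trans_le hpn
  have hp' : (0 : ℝ) < p := by exact_mod_cast hp
  set s : ℝ := p / n with hs
  have hs0 : 0 < s := by positivity
  have hs1 : s ≤ 1 := by rw [hs, div_le_one hn]; exact_mod_cast hpn
  have hns : n * s = p := by rw [hs]; field_simp
  have h1 : (∑ k ∈ Finset.Iic p, (n.choose k : ℝ)) * s ^ p ≤ Real.exp p := by
    calc (∑ k ∈ Finset.Iic p, (n.choose k : ℝ)) * s ^ p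
        ≤ ∑ k ∈ Finset.Iic p, s ^ k * (n.choose k : ℝ) := by
          rw [Finset.sum_mul]
          refine Finset.sum_le_sum fun k hk => ?_
          rw [mul_comm]
          exact mul_le_mul_of_nonneg_right
            (pow_le_pow_of_le_one hs0.le hs1 (Finset.mem_Iic.1 hk)) (by positivity)
      _ ≤ ∑ k ∈ Finset.range (n + 1), s ^ k * (n.choose k : ℝ) :=
          Finset.sum_le_sum_of_subset_of_nonneg
            (fun k hk => by have := Finset.mem_Iic.1 hk; simp; omega)
            fun _ _ _ => by positivity
      _ = (s + 1) ^ n := by simp [add_pow]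
      _ ≤ Real.exp s ^ n := by gcongr; exact Real.add_one_le_exp s
      _ = Real.exp p := by rw [← Real.exp_nat_mul, hns]
  have h2 : Real.exp (n * (s * Real.log (Real.exp 1 / s))) = Real.exp p / s ^ p := by
    rw [Real.log_div (Real.exp_pos 1).ne' hs0.ne', Real.log_exp, ← mul_assoc, hns, mul_sub,
      mul_one, Real.exp_sub, mul_comm, Real.exp_mul, Real.exp_log hs0, Real.rpow_natCast]
  rw [h2, le_div_iff₀ (by positivity)]
  exact h1

/-! ### The threshold equation -/

lemma strictMonoOn_mul_log_div :
    StrictMonoOn (fun s : ℝ => s * Real.log (Real.exp 1 / s)) (Set.Ioc 0 1) := by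
  have hcongr : Set.EqOn (fun s : ℝ => s + Real.negMulLog s)
      (fun s : ℝ => s * Real.log (Real.exp 1 / s)) (Set.Ioc 0 1) := fun s hs => by
    simp only
    rw [Real.log_div (Real.exp_pos 1).ne' hs.1.ne', Real.log_exp, Real.negMulLog]
    ring
  refine StrictMonoOn.congr ?_ hcongr
  refine strictMonoOn_of_deriv_pos (convex_Ioc 0 1)
    (continuous_id.add Real.continuous_negMulLog).continuousOn fun s hs => ?_
  rw [interior_Ioc] at hs
  have hd : HasDerivAt (fun s : ℝ => s + Real.negMulLog s) (1 + (-Real.log s - 1)) s :=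
    (hasDerivAt_id s).add (Real.hasDerivAt_negMulLog hs.1.ne')
  rw [hd.deriv]
  linarith [Real.log_neg hs.1 hs.2]

/-- Half-spaces through the origin of `ℝ^p` induce at most `exp (n s ln (e / s))` dichotomies of
`n` points if `p / n ≤ s ≤ 1`. -/
lemma card_halfspaces_le {n p : ℕ} (x : Fin n → EuclideanSpace ℝ (Fin p))
    (𝒜 : Finset (Finset (Fin n))) (h𝒜 : ∀ A ∈ 𝒜, ∃ θ, ∀ i, i ∈ A ↔ 0 < inner ℝ (x i) θ)
    (hp : 0 < p) (hn : 0 < n) {s : ℝ} (hs : (p : ℝ) / n ≤ s) (hs1 : s ≤ 1) :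
    (𝒜.card : ℝ) ≤ Real.exp (n * (s * Real.log (Real.exp 1 / s))) := by
  have hn' : (0 : ℝ) < n := by exact_mod_cast hn
  have hp' : (0 : ℝ) < p := by exact_mod_cast hp
  have hpn : p ≤ n := by
    have := hs.trans hs1
    rw [div_le_one hn'] at this
    exact_mod_cast this
  have h1 : 𝒜.card ≤ ∑ k ∈ Finset.Iic p, n.choose k := by
    refine (𝒜.card_le_card_shatterer.trans Finset.card_shatterer_le_sum_vcDim).trans ?_
    rw [Fintype.card_fin]
    exact Finset.sum_le_sum_of_subset (Finset.Iic_subset_Iic.2 (vcDim_halfspaces_le x 𝒜 h𝒜))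
  calc (𝒜.card : ℝ) ≤ ∑ k ∈ Finset.Iic p, (n.choose k : ℝ) := by exact_mod_cast h1
    _ ≤ _ := sum_choose_le_exp hp hpn
    _ ≤ _ := by
      gcongr Real.exp (n * ?_)
      have h0 : (0 : ℝ) < p / n := by positivity
      exact strictMonoOn_mul_log_div.monotoneOn ⟨h0, hs.trans hs1⟩ ⟨h0.trans_le hs, hs1⟩ hs

/-- The left-hand side `s + (2 s ln (e / s))^{1/2}` of the threshold equation. -/
def thresholdFun (s : ℝ) : ℝ := s + √(2 * s * Real.log (Real.exp 1 / s))

lemma strictMonoOn_thresholdFun : StrictMonoOn thresholdFun (Set.Ioc 0 1) := by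
  intro s hs t ht hst
  refine add_lt_add_of_lt_of_le hst (Real.sqrt_le_sqrt ?_)
  have := strictMonoOn_mul_log_div hs ht hst
  simp only at this
  nlinarith

lemma exists_unique_threshold {h : ℝ} (h0 : 0 < h) (h1 : h ≤ 1) :
    ∃ r ∈ Set.Ioo (0 : ℝ) 1, ∀ s ∈ Set.Ioo (0 : ℝ) 1, thresholdFun s = h ↔ s = r := by
  have hcont : Continuous fun s : ℝ => s + √(2 * (s + Real.negMulLog s)) := by fun_prop
  have heq : ∀ s, 0 < s → thresholdFun s = s + √(2 * (s + Real.negMulLog s)) := fun s hs => by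
    rw [thresholdFun, Real.log_div (Real.exp_pos 1).ne' hs.ne', Real.log_exp, Real.negMulLog]
    congr 2; ring
  have hlow : (fun s : ℝ => s + √(2 * (s + Real.negMulLog s))) 0 < h := by simpa using h0
  have hhigh : h < (fun s : ℝ => s + √(2 * (s + Real.negMulLog s))) 1 := by
    have : (0 : ℝ) < √2 := by positivity
    simp
    linarith
  obtain ⟨r, hr, hrh⟩ := intermediate_value_Ioo zero_le_one hcont.continuousOn ⟨hlow, hhigh⟩
  have hr' : thresholdFun r = h := by rw [heq r hr.1]; exact hrh
  refine ⟨r, hr, fun s hs => ⟨fun hsh => ?_, fun e => e ▸ hr'⟩⟩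
  exact strictMonoOn_thresholdFun.injOn (Set.Ioo_subset_Ioc_self hs) (Set.Ioo_subset_Ioc_self hr)
    (hsh.trans hr'.symm)

/-! ### General position of the covariates -/

section ConsVec

variable {d : ℕ}

lemma inner_consVec (a b : ℝ) (u v : EuclideanSpace ℝ (Fin d)) :
    inner ℝ (consVec a u) (consVec b v) = a * b + inner ℝ u v := by
  simp [consVec, PiLp.inner_apply, Fin.sum_univ_succ, mul_comm]

lemma exists_eq_consVec (θ : EuclideanSpace ℝ (Fin (d + 1))) :
    ∃ (a : ℝ) (u : EuclideanSpace ℝ (Fin d)), θ = consVec a u := by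
  refine ⟨θ 0, WithLp.toLp 2 fun j => θ j.succ, ?_⟩
  ext i
  refine Fin.cases ?_ (fun j => ?_) i <;> simp [consVec]

lemma continuous_consVec (a : ℝ) : Continuous (consVec a : EuclideanSpace ℝ (Fin d) → _) := by
  refine (PiLp.continuous_toLp 2 _).comp (continuous_pi fun i => ?_)
  refine Fin.cases ?_ (fun j => ?_) i
  · simpa using continuous_const
  · simp only [Fin.cons_succ]; fun_prop

lemma map_inner_stdGaussian (u : EuclideanSpace ℝ (Fin d)) :
    (stdGaussian (EuclideanSpace ℝ (Fin d))).map (fun v => inner ℝ v u) =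
      gaussianReal 0 (‖u‖ ^ 2).toNNReal := by
  have h := IsGaussian.map_eq_gaussianReal (μ := stdGaussian (EuclideanSpace ℝ (Fin d)))
    (innerSL ℝ u)
  rw [integral_strongDual_stdGaussian, variance_dual_stdGaussian, innerSL_apply_norm] at h
  rw [← h]
  congr 1
  funext v
  exact real_inner_comm _ _

/-- The law of `(1, v)`, for `v` standard Gaussian, charges no hyperplane through the origin. -/
lemma stdGaussian_hyperplane_eq_zero {θ : EuclideanSpace ℝ (Fin (d + 1))} (hθ : θ ≠ 0) :
    ((stdGaussian (EuclideanSpace ℝ (Fin d))).map (consVec 1)) {v | inner ℝ v θ = 0} = 0 := by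
  obtain ⟨a, u, rfl⟩ := exists_eq_consVec θ
  have hm : MeasurableSet {v : EuclideanSpace ℝ (Fin (d + 1)) | inner ℝ v (consVec a u) = 0} :=
    (isClosed_eq (by fun_prop) continuous_const).measurableSet
  rw [Measure.map_apply (continuous_consVec 1).measurable hm]
  have hset : consVec 1 ⁻¹' {v : EuclideanSpace ℝ (Fin (d + 1)) | inner ℝ v (consVec a u) = 0} =
      (fun v => inner ℝ v u) ⁻¹' {-a} := by
    ext v
    simp only [Set.mem_preimage, Set.mem_ofPred_eq, inner_consVec, Set.mem_singleton_iff]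
    constructor <;> intro h <;> linarith
  rw [hset, ← Measure.map_apply (by fun_prop) (measurableSet_singleton _), map_inner_stdGaussian]
  by_cases hu : u = 0
  · have ha : a ≠ 0 := by
      rintro rfl
      apply hθ
      subst hu
      ext i
      refine Fin.cases ?_ (fun j => ?_) i <;> simp [consVec]
    simp [hu, ha]
  · have : NullSingletonClass (gaussianReal 0 (‖u‖ ^ 2).toNNReal) := by
      refine nullSingletonClass_gaussianReal (ne_of_gt ?_)
      rw [Real.toNNReal_pos]
      positivity
    exact measure_singleton _

end ConsVec

/-- At most `p` independent random vectors of `ℝ^p` whose common law charges no hyperplane are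
almost surely linearly independent. -/
lemma ae_linearIndependent_pi {p : ℕ} (ν : Measure (EuclideanSpace ℝ (Fin p)))
    [IsProbabilityMeasure ν] (hν : ∀ u ≠ 0, ν {v | inner ℝ v u = 0} = 0) (k : ℕ) (hk : k ≤ p) :
    ∀ᵐ v ∂(Measure.pi fun _ : Fin k => ν), LinearIndependent ℝ v := by
  induction k with
  | zero => exact Eventually.of_forall fun v => linearIndependent_empty_type
  | succ k ih =>
    have hmp := measurePreserving_piFinSuccAbove (fun _ : Fin (k + 1) => ν) 0
    set e := MeasurableEquiv.piFinSuccAbove (fun _ : Fin (k + 1) => EuclideanSpace ℝ (Fin p)) 0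
    have hB : MeasurableSet {v : Fin (k + 1) → EuclideanSpace ℝ (Fin p) |
        ¬ LinearIndependent ℝ v} :=
      isOpen_setOfPred_linearIndependent.measurableSet.compl
    rw [ae_iff, ← (hmp.symm e).measure_preimage hB.nullMeasurableSet,
      Measure.prod_apply_symm ((hmp.symm e).measurable hB), lintegral_eq_zero_iff' ?_]
    · filter_upwards [ih (by omega)] with w hw
      obtain ⟨u, hu, hu0⟩ : ∃ u ∈ (Submodule.span ℝ (Set.range w))ᗮ, u ≠ 0 := by
        rw [← Submodule.ne_bot_iff, Ne, Submodule.orthogonal_eq_bot_iff]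
        intro htop
        have h1 := finrank_range_le_card (R := ℝ) w
        rw [Set.finrank, htop, finrank_top, finrank_euclideanSpace_fin, Fintype.card_fin] at h1
        omega
      refine measure_mono_null (fun v hv => ?_) (hν u hu0)
      have hv' : ¬ LinearIndependent ℝ (Fin.cons v w : Fin (k + 1) → EuclideanSpace ℝ (Fin p)) := by
        simpa [e, MeasurableEquiv.piFinSuccAbove, Fin.insertNthEquiv] using hv
      rw [linearIndependent_finCons] at hv'
      have hmem : v ∈ Submodule.span ℝ (Set.range w) := by
        by_contra h
        exact hv' ⟨hw, h⟩
      exact (Submodule.mem_orthogonal _ _).1 hu v hmem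
    · exact (measurable_measure_prodMk_right ((hmp.symm e).measurable hB)).aemeasurable

/-- Almost surely, any `d + 1` of the extended covariates `(1, x_i)` span `ℝ^{d+1}`. -/
lemma ae_general_position {Ω : Type*} [MeasurableSpace Ω] {μ : Measure Ω}
    {n d : ℕ} {x : Fin n → Ω → EuclideanSpace ℝ (Fin d)} (hx : ∀ i, Measurable (x i))
    (hind : iIndepFun x μ) (hlaw : ∀ i, μ.map (x i) = stdGaussian (EuclideanSpace ℝ (Fin d))) :
    ∀ᵐ ω ∂μ, ∀ S : Finset (Fin n), d + 1 ≤ S.card →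
      ∀ v, (∀ i ∈ S, inner ℝ (consVec 1 (x i ω)) v = 0) → v = 0 := by
  have hc : Measurable (consVec 1 : EuclideanSpace ℝ (Fin d) → _) :=
    (continuous_consVec 1).measurable
  have : IsProbabilityMeasure ((stdGaussian (EuclideanSpace ℝ (Fin d))).map (consVec 1)) :=
    Measure.isProbabilityMeasure_map hc.aemeasurable
  have key : ∀ᵐ ω ∂μ, ∀ f : Fin (d + 1) ↪ Fin n,
      LinearIndependent ℝ fun j => consVec 1 (x (f j) ω) := by
    rw [ae_all_iff]
    intro f
    have hi : iIndepFun (fun j ω => consVec 1 (x (f j) ω)) μ :=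
      (hind.precomp f.injective).comp (fun _ => consVec 1) fun _ => hc
    have hm : ∀ j, Measurable fun ω => consVec 1 (x (f j) ω) := fun j => hc.comp (hx _)
    have hmap := hi.map_fun_eq_pi_map fun j => (hm j).aemeasurable
    have hmap' : ∀ j, μ.map (fun ω => consVec 1 (x (f j) ω)) =
        (stdGaussian (EuclideanSpace ℝ (Fin d))).map (consVec 1) := fun j => by
      rw [← hlaw (f j), Measure.map_map hc (hx _)]
      rfl
    simp_rw [hmap'] at hmap
    have h := ae_linearIndependent_pi _ (fun u hu => stdGaussian_hyperplane_eq_zero hu) (d + 1)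
      le_rfl
    rw [← hmap] at h
    exact ae_of_ae_map (measurable_pi_lambda _ hm).aemeasurable h
  filter_upwards [key] with ω hω S hS v hv
  obtain ⟨g⟩ : Nonempty (Fin (d + 1) ↪ S) :=
    Function.Embedding.nonempty_of_card_le (by simpa using hS)
  have hli := hω (g.trans (Function.Embedding.subtype _))
  have htop : Submodule.span ℝ
      (Set.range fun j => consVec 1 (x (g.trans (Function.Embedding.subtype _) j) ω)) = ⊤ :=
    hli.span_eq_top_of_card_eq_finrank (by simp)
  have hv' : v ∈ (⊤ : Submodule ℝ (EuclideanSpace ℝ (Fin (d + 1))))ᗮ := by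
    rw [← htop, Submodule.mem_orthogonal]
    intro u hu
    induction hu using Submodule.span_induction with
    | mem u hu => obtain ⟨j, rfl⟩ := hu; exact hv _ (g j).2
    | zero => simp
    | add a b _ _ ha hb => rw [inner_add_left, ha, hb, add_zero]
    | smul c a _ ha => rw [real_inner_smul_left, ha, mul_zero]
  simpa using hv'

/-! ### Error counts of a fixed classifier -/

/-- The conditional probability, given scores `w i`, that exactly the responses with index in `T`
are positive. -/
def labelProb {n : ℕ} (w : Fin n → ℝ) (T : Finset (Fin n)) : ℝ :=
  ∏ i, if i ∈ T then Phi (w i) else Phi (-w i)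

/-- The number of indices at which the labelling `T` disagrees with the classifier `A`. -/
def errorCount {n : ℕ} (A T : Finset (Fin n)) : ℕ :=
  (Finset.univ.filter fun i => ¬ (i ∈ A ↔ i ∈ T)).card

lemma labelProb_nonneg {n : ℕ} (w : Fin n → ℝ) (T : Finset (Fin n)) : 0 ≤ labelProb w T :=
  Finset.prod_nonneg fun i _ => by split_ifs <;> exact Phi_nonneg _

lemma labelProb_le_one {n : ℕ} (w : Fin n → ℝ) (T : Finset (Fin n)) : labelProb w T ≤ 1 :=
  Finset.prod_le_one (fun i _ => by split_ifs <;> exact Phi_nonneg _)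
    fun i _ => by split_ifs <;> exact Phi_le_one _

lemma continuous_labelProb {n : ℕ} (T : Finset (Fin n)) :
    Continuous fun w : Fin n → ℝ => labelProb w T := by
  refine continuous_finsetProd _ fun i _ => ?_
  split_ifs
  · exact continuous_Phi.comp (continuous_apply i)
  · exact continuous_Phi.comp (continuous_apply i).neg

/-- The Laplace transform of the number of errors of any classifier is at most that of the Bayes
classifier, which errs at `i` with conditional probability `Φ(-|w i|)`. -/
lemma sum_labelProb_le {n : ℕ} (w : Fin n → ℝ) (A : Finset (Fin n)) {a : ℝ} (ha : 0 ≤ a) :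
    ∑ T, Real.exp (-a * errorCount A T) * labelProb w T ≤
      ∏ i, (1 - (1 - Real.exp (-a)) * Phi (-|w i|)) := by
  have hterm : ∀ T : Finset (Fin n), Real.exp (-a * errorCount A T) * labelProb w T =
      (∏ i ∈ T, Phi (w i) * (if i ∈ A then 1 else Real.exp (-a))) *
        ∏ i ∈ Finset.univ \ T, Phi (-w i) * (if i ∈ A then Real.exp (-a) else 1) := by
    intro T
    have h1 : Real.exp (-a * errorCount A T) =
        ∏ i, if (i ∈ A ↔ i ∈ T) then 1 else Real.exp (-a) := by
      rw [mul_comm, Real.exp_nat_mul, errorCount, Finset.prod_ite, Finset.prod_const_one, one_mul,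
        Finset.prod_const]
    rw [h1, labelProb, ← Finset.prod_mul_distrib, ← Finset.prod_sdiff (Finset.subset_univ T),
      mul_comm]
    congr 1
    · refine Finset.prod_congr rfl fun i hi => ?_
      simp [hi, mul_comm]
    · refine Finset.prod_congr rfl fun i hi => ?_
      have hi' : i ∉ T := by simpa using hi
      by_cases hA : i ∈ A <;> simp [hi', hA, mul_comm]
  calc ∑ T, Real.exp (-a * errorCount A T) * labelProb w T
      = ∏ i, (Phi (w i) * (if i ∈ A then 1 else Real.exp (-a)) +
          Phi (-w i) * (if i ∈ A then Real.exp (-a) else 1)) := by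
        rw [Finset.prod_add, Finset.powerset_univ]
        exact Finset.sum_congr rfl fun T _ => hterm T
    _ ≤ _ := by
        have he : Real.exp (-a) ≤ 1 := Real.exp_le_one_iff.2 (by linarith)
        refine Finset.prod_le_prod (fun i _ => ?_) fun i _ => ?_
        · have h1 := Phi_nonneg (w i)
          have h2 := Phi_nonneg (-w i)
          split_ifs <;> positivity
        · have h1 : Phi (-|w i|) ≤ Phi (w i) := strictMono_Phi.monotone (neg_abs_le _)
          have h2 : Phi (-|w i|) ≤ Phi (-w i) :=
            strictMono_Phi.monotone (neg_le_neg (le_abs_self _))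
          have h3 := Phi_neg (w i)
          split_ifs <;> nlinarith

section Model

variable {Ω : Type*} [MeasurableSpace Ω] {μ : Measure Ω} {n d : ℕ}
  {x : Fin n → Ω → EuclideanSpace ℝ (Fin d)} {y : Fin n → Ω → ℝ}
  {β₀ : ℝ} {β : EuclideanSpace ℝ (Fin d)}

lemma covariateSigma_le (M : GaussianProbitModel μ x y β₀ β) :
    covariateSigma x ≤ ‹MeasurableSpace Ω› :=
  (measurable_pi_lambda _ M.measurable_x).comap_le

/-- The event that exactly the responses with index in `T` equal `1`. -/
def labelEvent (y : Fin n → Ω → ℝ) (T : Finset (Fin n)) : Set Ω :=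
  ⋂ i, y i ⁻¹' (if i ∈ T then {1} else {-1})

lemma measurableSet_labelEvent (M : GaussianProbitModel μ x y β₀ β) (T : Finset (Fin n)) :
    MeasurableSet (labelEvent y T) :=
  MeasurableSet.iInter fun i => M.measurable_y i (by split_ifs <;> exact measurableSet_singleton _)

lemma condExp_labelEvent [IsProbabilityMeasure μ]
    (M : GaussianProbitModel μ x y β₀ β) (T : Finset (Fin n)) :
    μ⟦labelEvent y T | covariateSigma x⟧ =ᵐ[μ]
      fun ω => labelProb (fun i => inner ℝ (consVec 1 (x i ω)) (consVec β₀ β)) T := by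
  have hm := covariateSigma_le M
  have h := M.condIndep_y (fun i => if i ∈ T then {1} else {-1})
    fun i => by split_ifs <;> exact measurableSet_singleton _
  have hneg : ∀ i, μ⟦y i ⁻¹' {-1} | covariateSigma x⟧ =ᵐ[μ]
      fun ω => Phi (-inner ℝ (consVec 1 (x i ω)) (consVec β₀ β)) := fun i => by
    have hset : (y i ⁻¹' {-1}).indicator (fun _ => (1 : ℝ)) =
        (fun _ => (1 : ℝ)) - (y i ⁻¹' {1}).indicator (fun _ => (1 : ℝ)) := by
      funext ω
      rcases M.y_mem i ω with h | h
      · have : (-1 : ℝ) ≠ 1 := by norm_num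
        simp [Set.indicator, h, this]
      · have : (1 : ℝ) ≠ -1 := by norm_num
        simp [Set.indicator, h, this]
    have h1 := condExp_sub (m := covariateSigma x) (integrable_const (1 : ℝ) (μ := μ))
      ((integrable_const (1 : ℝ)).indicator (M.measurable_y i (measurableSet_singleton 1)))
    rw [hset]
    filter_upwards [h1, M.condLaw_y i] with ω h1 h2
    rw [h1, Pi.sub_apply, h2, condExp_const hm, Phi_neg]
  have hall : ∀ᵐ ω ∂μ, ∀ i, (μ⟦y i ⁻¹' (if i ∈ T then {1} else {-1}) | covariateSigma x⟧) ω =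
      if i ∈ T then Phi (inner ℝ (consVec 1 (x i ω)) (consVec β₀ β))
      else Phi (-inner ℝ (consVec 1 (x i ω)) (consVec β₀ β)) := by
    rw [ae_all_iff]
    intro i
    by_cases hi : i ∈ T
    · filter_upwards [M.condLaw_y i] with ω h
      simpa [hi] using h
    · filter_upwards [hneg i] with ω h
      simpa [hi] using h
  filter_upwards [h, hall] with ω h1 h2
  rw [labelEvent, h1, labelProb]
  exact Finset.prod_congr rfl fun i _ => h2 i

lemma measurable_score (M : GaussianProbitModel μ x y β₀ β) (i : Fin n) :
    Measurable fun ω => inner ℝ (consVec 1 (x i ω)) (consVec β₀ β) :=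
  (show Continuous fun v : EuclideanSpace ℝ (Fin d) => inner ℝ (consVec 1 v) (consVec β₀ β) from
    (continuous_consVec 1).inner continuous_const).measurable.comp (M.measurable_x i)

lemma integrable_labelProb [IsProbabilityMeasure μ]
    (M : GaussianProbitModel μ x y β₀ β) (T : Finset (Fin n)) :
    Integrable (fun ω => labelProb (fun i => inner ℝ (consVec 1 (x i ω)) (consVec β₀ β)) T) μ := by
  refine Integrable.of_bound (C := 1) ((continuous_labelProb T).measurable.comp
    (measurable_pi_lambda _ (measurable_score M))).aestronglyMeasurable
    (Eventually.of_forall fun ω => ?_)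
  rw [Real.norm_of_nonneg (labelProb_nonneg _ _)]
  exact labelProb_le_one _ _

lemma measureReal_inter_labelEvent [IsProbabilityMeasure μ]
    (M : GaussianProbitModel μ x y β₀ β) (T : Finset (Fin n))
    {C : Set Ω} (hC : MeasurableSet[covariateSigma x] C) :
    μ.real (C ∩ labelEvent y T) = ∫ ω, C.indicator
      (fun ω => labelProb (fun i => inner ℝ (consVec 1 (x i ω)) (consVec β₀ β)) T) ω ∂μ := by
  have hm := covariateSigma_le M
  rw [integral_indicator (hm C hC),
    ← setIntegral_congr_ae (hm C hC) ((condExp_labelEvent M T).mono fun ω h _ => h),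
    setIntegral_condExp hm ((integrable_const 1).indicator (measurableSet_labelEvent M T)) hC,
    integral_indicator (measurableSet_labelEvent M T), Measure.restrict_restrict
      (measurableSet_labelEvent M T), setIntegral_const, smul_eq_mul, mul_one, Set.inter_comm]

lemma map_inner_covariate (M : GaussianProbitModel μ x y β₀ β) (i : Fin n) :
    μ.map (fun ω => inner ℝ (x i ω) β) = gaussianReal 0 (‖β‖ ^ 2).toNNReal := by
  rw [← map_inner_stdGaussian, ← M.law_x i, Measure.map_map (by fun_prop) (M.measurable_x i)]
  rfl

lemma variance_inner_covariate (M : GaussianProbitModel μ x y β₀ β) (i : Fin n) :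
    Var[fun ω => inner ℝ (x i ω) β; μ] = ‖β‖ ^ 2 := by
  have h1 := map_inner_covariate M i
  have hmeas : Measurable fun ω => inner ℝ (x i ω) β := by
    have := M.measurable_x i
    fun_prop
  have h2 := variance_id_gaussianReal (μ := 0) (v := (‖β‖ ^ 2).toNNReal)
  rw [← h1, variance_map aemeasurable_id hmeas.aemeasurable] at h2
  rw [Function.id_comp] at h2
  rw [h2, Real.coe_toNNReal _ (sq_nonneg _)]

lemma measurable_Phi_neg_abs : Measurable fun w : ℝ => Phi (-|w|) :=
  (continuous_Phi.comp continuous_abs.neg).measurable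

/-- The Bayes error at each data point is `h`. -/
lemma integral_bayes_error (M : GaussianProbitModel μ x y β₀ β) (i : Fin n) :
    ∫ ω, Phi (-|inner ℝ (consVec 1 (x i ω)) (consVec β₀ β)|) ∂μ = hConst β₀ ‖β‖ := by
  have hf : Measurable fun t : ℝ => Phi (-|β₀ + t|) :=
    measurable_Phi_neg_abs.comp (measurable_const.add measurable_id)
  have h1 := map_inner_covariate M i
  have h2 : (gaussianReal 0 1).map (fun z => ‖β‖ * z) = gaussianReal 0 (‖β‖ ^ 2).toNNReal := by
    rw [gaussianReal_map_const_mul, mul_zero, mul_one]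
    congr 1
    ext
    simp
  have hmeas : Measurable fun ω => inner ℝ (x i ω) β := by
    have := M.measurable_x i
    fun_prop
  simp_rw [inner_consVec, one_mul, hConst]
  rw [← integral_map (φ := fun ω => inner ℝ (x i ω) β) (f := fun t => Phi (-|β₀ + t|))
    hmeas.aemeasurable hf.aestronglyMeasurable, h1, ← h2,
    integral_map (by fun_prop) hf.aestronglyMeasurable]

lemma integrable_Phi_neg_abs [IsProbabilityMeasure μ] {f : Ω → ℝ} (hf : Measurable f) :
    Integrable (fun ω => Phi (-|f ω|)) μ := by
  refine Integrable.of_bound (C := 1) (measurable_Phi_neg_abs.comp hf).aestronglyMeasurable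
    (Eventually.of_forall fun ω => ?_)
  rw [Real.norm_of_nonneg (Phi_nonneg _)]
  exact Phi_le_one _

lemma integral_prod_bayes [IsProbabilityMeasure μ] (M : GaussianProbitModel μ x y β₀ β) (b : ℝ) :
    ∫ ω, ∏ i, (1 - b * Phi (-|inner ℝ (consVec 1 (x i ω)) (consVec β₀ β)|)) ∂μ =
      (1 - b * hConst β₀ ‖β‖) ^ n := by
  have hc : Measurable fun v : EuclideanSpace ℝ (Fin d) =>
      1 - b * Phi (-|inner ℝ (consVec 1 v) (consVec β₀ β)|) :=
    measurable_const.sub (measurable_const.mul (measurable_Phi_neg_abs.comp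
      ((continuous_consVec 1).inner continuous_const).measurable))
  rw [M.indep_x.integral_fun_prod_comp
    (f := fun _ v => 1 - b * Phi (-|inner ℝ (consVec 1 v) (consVec β₀ β)|))
    (fun i => (M.measurable_x i).aemeasurable) fun i => hc.aestronglyMeasurable]
  have : ∀ i, ∫ ω, (1 - b * Phi (-|inner ℝ (consVec 1 (x i ω)) (consVec β₀ β)|)) ∂μ =
      1 - b * hConst β₀ ‖β‖ := fun i => by
    rw [integral_sub (integrable_const _)
      ((integrable_Phi_neg_abs (measurable_score M i)).const_mul b), integral_const_mul,
      integral_bayes_error M i]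
    simp
  simp [this]

end Model

lemma hConst_pos (β₀ γ₀ : ℝ) : 0 < hConst β₀ γ₀ := by
  have hint : Integrable (fun z => Phi (-|β₀ + γ₀ * z|)) (gaussianReal 0 1) :=
    integrable_Phi_neg_abs (by fun_prop)
  refine (integral_pos_iff_support_of_nonneg (fun z => Phi_nonneg _) hint).2 ?_
  have : Function.support (fun z => Phi (-|β₀ + γ₀ * z|)) = Set.univ :=
    Set.eq_univ_of_forall fun z => (Phi_pos _).ne'
  simp [this]

lemma hConst_le_one (β₀ γ₀ : ℝ) : hConst β₀ γ₀ ≤ 1 := by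
  have h := integral_mono (μ := gaussianReal 0 1) (integrable_Phi_neg_abs (by fun_prop))
    (integrable_const (1 : ℝ)) (fun z => Phi_le_one (-|β₀ + γ₀ * z|))
  simpa [hConst] using h

/-! ### The probability that a half-space makes few errors -/

/-- The event that some vector of a dense sequence has at most `d` signed extended covariates in
its closed negative half-space. -/
def fewErrors {Ω : Type*} {n d : ℕ} (x : Fin n → Ω → EuclideanSpace ℝ (Fin d))
    (y : Fin n → Ω → ℝ) : Set Ω :=
  {ω | ∃ k : ℕ, (Finset.univ.filter fun i => inner ℝ (y i ω • consVec 1 (x i ω))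
    (TopologicalSpace.denseSeq (EuclideanSpace ℝ (Fin (d + 1))) k) ≤ 0).card ≤ d}

/-- The event that the half-space of some vector of a dense sequence cuts out exactly the extended
covariates with index in `A`. -/
def cutsOut {Ω : Type*} {n d : ℕ} (x : Fin n → Ω → EuclideanSpace ℝ (Fin d))
    (A : Finset (Fin n)) : Set Ω :=
  {ω | ∃ k : ℕ, ∀ i, i ∈ A ↔ 0 < inner ℝ (consVec 1 (x i ω))
    (TopologicalSpace.denseSeq (EuclideanSpace ℝ (Fin (d + 1))) k)}

/-- The dense sequence loses nothing, since positivity of finitely many inner products is an open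
condition. -/
lemma mem_fewErrors_iff {Ω : Type*} {n d : ℕ} {x : Fin n → Ω → EuclideanSpace ℝ (Fin d)}
    {y : Fin n → Ω → ℝ} {ω : Ω} : ω ∈ fewErrors x y ↔
      ∃ θ, (Finset.univ.filter fun i => inner ℝ (y i ω • consVec 1 (x i ω)) θ ≤ 0).card ≤ d := by
  refine ⟨fun ⟨k, hk⟩ => ⟨_, hk⟩, fun ⟨θ, hθ⟩ => ?_⟩
  let U : Set (EuclideanSpace ℝ (Fin (d + 1))) :=
    ⋂ i ∈ {i | 0 < inner ℝ (y i ω • consVec 1 (x i ω)) θ},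
      {θ' | 0 < inner ℝ (y i ω • consVec 1 (x i ω)) θ'}
  have hU : IsOpen U := (Set.toFinite _).isOpen_biInter fun i _ =>
    isOpen_lt continuous_const (by fun_prop)
  obtain ⟨k, hk⟩ := (TopologicalSpace.denseRange_denseSeq _).exists_mem_open hU
    ⟨θ, Set.mem_iInter₂.2 fun i hi => hi⟩
  refine ⟨k, (Finset.card_le_card fun i hi => ?_).trans hθ⟩
  simp only [Finset.mem_filter, Finset.mem_univ, true_and] at hi ⊢
  by_contra! h
  exact absurd (Set.mem_iInter₂.1 hk i h) (not_lt.2 hi)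

lemma measurableSet_cutsOut {Ω : Type*} {n d : ℕ}
    {x : Fin n → Ω → EuclideanSpace ℝ (Fin d)} (A : Finset (Fin n)) :
    MeasurableSet[covariateSigma x] (cutsOut x A) := by
  refine ⟨{v | ∃ k : ℕ, ∀ i, i ∈ A ↔ 0 < inner ℝ (consVec 1 (v i))
    (TopologicalSpace.denseSeq (EuclideanSpace ℝ (Fin (d + 1))) k)}, ?_, rfl⟩
  simp only [Set.ofPred_exists, Set.ofPred_forall]
  refine MeasurableSet.iUnion fun k => MeasurableSet.iInter fun i => ?_
  have hm : Measurable fun v : Fin n → EuclideanSpace ℝ (Fin d) => inner ℝ (consVec 1 (v i))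
      (TopologicalSpace.denseSeq (EuclideanSpace ℝ (Fin (d + 1))) k) :=
    ((continuous_consVec 1).measurable.comp (measurable_pi_apply i)).inner measurable_const
  by_cases hi : i ∈ A
  · simpa [hi] using measurableSet_lt measurable_const hm
  · simpa [hi] using measurableSet_le hm measurable_const

section Model

variable {Ω : Type*} [MeasurableSpace Ω] {μ : Measure Ω} {n d : ℕ}
  {x : Fin n → Ω → EuclideanSpace ℝ (Fin d)} {y : Fin n → Ω → ℝ}
  {β₀ : ℝ} {β : EuclideanSpace ℝ (Fin d)}

lemma measurableSet_fewErrors (hx : ∀ i, Measurable (x i)) (hy : ∀ i, Measurable (y i)) :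
    MeasurableSet (fewErrors x y) := by
  have hset : fewErrors x y = ⋃ k : ℕ, ⋃ S ∈ {S : Finset (Fin n) | S.card ≤ d},
      ⋂ i, {ω | i ∉ S → 0 < inner ℝ (y i ω • consVec 1 (x i ω))
        (TopologicalSpace.denseSeq (EuclideanSpace ℝ (Fin (d + 1))) k)} := by
    ext ω
    simp only [fewErrors, Set.mem_ofPred_eq, Set.mem_iUnion, Set.mem_iInter, exists_prop]
    refine exists_congr fun k => ⟨fun h => ⟨_, h, fun i hi => ?_⟩, fun ⟨S, hS, h⟩ => ?_⟩
    · simpa using hi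
    · refine (Finset.card_le_card fun i hi => ?_).trans hS
      by_contra hiS
      exact absurd (h i hiS) (not_lt.2 (by simpa using hi))
  rw [hset]
  refine MeasurableSet.iUnion fun k => MeasurableSet.biUnion (Set.to_countable _) fun S _ =>
    MeasurableSet.iInter fun i => ?_
  by_cases hi : i ∈ S
  · simp [hi]
  · have hm : Measurable fun ω => inner ℝ (y i ω • consVec 1 (x i ω))
        (TopologicalSpace.denseSeq (EuclideanSpace ℝ (Fin (d + 1))) k) :=
      ((hy i).smul ((continuous_consVec 1).measurable.comp (hx i))).inner measurable_const
    simpa [hi] using measurableSet_lt measurable_const hm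

lemma fewErrors_subset (M : GaussianProbitModel μ x y β₀ β) :
    fewErrors x y ⊆ ⋃ A, ⋃ T ∈ (Finset.univ.filter fun T => errorCount A T ≤ d),
      cutsOut x A ∩ labelEvent y T := by
  rintro ω ⟨k, hk⟩
  set θ := TopologicalSpace.denseSeq (EuclideanSpace ℝ (Fin (d + 1))) k
  set A := Finset.univ.filter fun i => 0 < inner ℝ (consVec 1 (x i ω)) θ with hA
  set T := Finset.univ.filter fun i => y i ω = 1 with hT
  simp only [Set.mem_iUnion, exists_prop, Finset.mem_filter, Finset.mem_univ, true_and]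
  refine ⟨A, T, (Finset.card_le_card fun i hi => ?_).trans hk, ⟨k, fun i => by simp [hA, θ]⟩, ?_⟩
  · simp only [Finset.mem_filter, Finset.mem_univ, true_and, hA, hT] at hi ⊢
    rw [real_inner_smul_left]
    rcases M.y_mem i ω with h | h
    · have h1 : (-1 : ℝ) ≠ 1 := by norm_num
      simp only [h, h1, iff_false, not_not] at hi
      rw [h]; linarith
    · simp only [h, iff_true, not_lt] at hi
      rw [h]; linarith
  · simp only [labelEvent, Set.mem_iInter, Set.mem_preimage]
    intro i
    by_cases h : y i ω = 1
    · simp [hT, h]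
    · simpa [hT, h] using (M.y_mem i ω).resolve_right h

/-- A union bound over the classifiers cut out by half-spaces, combined with an exponential
Markov bound for the number of errors of each, both conditionally on the covariates. -/
lemma measureReal_fewErrors_le [IsProbabilityMeasure μ] (M : GaussianProbitModel μ x y β₀ β)
    (hn : 0 < n) {s : ℝ} (hs : ((d : ℝ) + 1) / n ≤ s) (hs1 : s ≤ 1) {a : ℝ} (ha : 0 ≤ a) :
    μ.real (fewErrors x y) ≤ Real.exp (a * d) * (Real.exp (n * (s * Real.log (Real.exp 1 / s))) *
      (1 - (1 - Real.exp (-a)) * hConst β₀ ‖β‖) ^ n) := by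
  set w : Ω → Fin n → ℝ := fun ω i => inner ℝ (consVec 1 (x i ω)) (consVec β₀ β) with hw
  set K := Real.exp (n * (s * Real.log (Real.exp 1 / s))) with hK
  have hC : ∀ A, MeasurableSet (cutsOut x A) := fun A =>
    covariateSigma_le M _ (measurableSet_cutsOut A)
  have hint : ∀ A T, Integrable ((cutsOut x A).indicator fun ω => labelProb (w ω) T) μ :=
    fun A T => (integrable_labelProb M T).indicator (hC A)
  have hnn : ∀ A T, 0 ≤ ∫ ω, (cutsOut x A).indicator (fun ω => labelProb (w ω) T) ω ∂μ :=
    fun A T => integral_nonneg fun ω => Set.indicator_nonneg (fun ω _ => labelProb_nonneg _ _) ω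
  have he : Real.exp (-a) ≤ 1 := Real.exp_le_one_iff.2 (by linarith)
  have hq0 : ∀ ω, 0 ≤ ∏ i, (1 - (1 - Real.exp (-a)) * Phi (-|w ω i|)) := fun ω =>
    Finset.prod_nonneg fun i _ => by
      nlinarith [Phi_nonneg (-|w ω i|), Phi_le_one (-|w ω i|), Real.exp_pos (-a)]
  have hqint : Integrable (fun ω => ∏ i, (1 - (1 - Real.exp (-a)) * Phi (-|w ω i|))) μ := by
    refine Integrable.of_bound (C := 1) (Measurable.aestronglyMeasurable ?_)
      (Eventually.of_forall fun ω => ?_)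
    · exact Finset.measurable_fun_prod _ fun i _ => measurable_const.sub
        (measurable_const.mul (measurable_Phi_neg_abs.comp (measurable_score M i)))
    · rw [Real.norm_of_nonneg (hq0 ω)]
      refine Finset.prod_le_one (fun i _ => ?_) fun i _ => ?_ <;>
      nlinarith [Phi_nonneg (-|w ω i|), Phi_le_one (-|w ω i|), Real.exp_pos (-a)]
  have hpoint : ∀ ω, ∑ A, ∑ T, Real.exp (-a * errorCount A T) *
      (cutsOut x A).indicator (fun ω => labelProb (w ω) T) ω ≤
      K * ∏ i, (1 - (1 - Real.exp (-a)) * Phi (-|w ω i|)) := by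
    intro ω
    classical
    calc ∑ A, ∑ T, Real.exp (-a * errorCount A T) *
        (cutsOut x A).indicator (fun ω => labelProb (w ω) T) ω
        ≤ ∑ A, if ω ∈ cutsOut x A then ∏ i, (1 - (1 - Real.exp (-a)) * Phi (-|w ω i|)) else 0 := by
          refine Finset.sum_le_sum fun A _ => ?_
          by_cases h : ω ∈ cutsOut x A
          · simpa [h] using sum_labelProb_le (w ω) A ha
          · simp [h]
      _ = (Finset.univ.filter fun A => ω ∈ cutsOut x A).card *
            ∏ i, (1 - (1 - Real.exp (-a)) * Phi (-|w ω i|)) := by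
          rw [← Finset.sum_filter, Finset.sum_const, nsmul_eq_mul]
      _ ≤ _ := by
          refine mul_le_mul_of_nonneg_right ?_ (hq0 ω)
          refine card_halfspaces_le (fun i => consVec 1 (x i ω)) _ (fun A hA => ?_)
            d.succ_pos hn (by exact_mod_cast hs) hs1
          obtain ⟨k, hk⟩ := (Finset.mem_filter.1 hA).2
          exact ⟨_, hk⟩
  calc μ.real (fewErrors x y)
      ≤ ∑ A, ∑ T ∈ Finset.univ.filter fun T => errorCount A T ≤ d,
          μ.real (cutsOut x A ∩ labelEvent y T) := by
        refine (measureReal_mono (fewErrors_subset M)).trans ?_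
        refine (measureReal_iUnion_fintype_le _).trans (Finset.sum_le_sum fun A _ => ?_)
        exact measureReal_biUnion_finset_le _ _
    _ ≤ ∑ A, ∑ T, Real.exp (a * d) * (Real.exp (-a * errorCount A T) *
          ∫ ω, (cutsOut x A).indicator (fun ω => labelProb (w ω) T) ω ∂μ) := by
        refine Finset.sum_le_sum fun A _ => ?_
        refine (Finset.sum_le_sum fun T hT => ?_).trans (Finset.sum_le_sum_of_subset_of_nonneg
          (Finset.filter_subset _ _) fun T _ _ => mul_nonneg (Real.exp_pos _).le
            (mul_nonneg (Real.exp_pos _).le (hnn A T)))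
        rw [measureReal_inter_labelEvent M T (measurableSet_cutsOut A), ← mul_assoc,
          ← Real.exp_add]
        refine le_mul_of_one_le_left (hnn A T) (Real.one_le_exp ?_)
        have : (errorCount A T : ℝ) ≤ d := by exact_mod_cast (Finset.mem_filter.1 hT).2
        nlinarith
    _ = Real.exp (a * d) * ∫ ω, ∑ A, ∑ T, Real.exp (-a * errorCount A T) *
          (cutsOut x A).indicator (fun ω => labelProb (w ω) T) ω ∂μ := by
        rw [integral_finsetSum _ fun A _ => integrable_finsetSum _ fun T _ =>
          (hint A T).const_mul _, Finset.mul_sum]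
        refine Finset.sum_congr rfl fun A _ => ?_
        rw [integral_finsetSum _ fun T _ => (hint A T).const_mul _, Finset.mul_sum]
        exact Finset.sum_congr rfl fun T _ => by rw [integral_const_mul]
    _ ≤ Real.exp (a * d) * ∫ ω, K * ∏ i, (1 - (1 - Real.exp (-a)) * Phi (-|w ω i|)) ∂μ := by
        refine mul_le_mul_of_nonneg_left (integral_mono ?_ (hqint.const_mul K) hpoint)
          (Real.exp_pos _).le
        exact integrable_finsetSum _ fun A _ => integrable_finsetSum _ fun T _ =>
          (hint A T).const_mul _
    _ = _ := by rw [integral_const_mul, integral_prod_bayes M]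

/-- Optimizing the exponential Markov bound at the parameter `h - s`. -/
lemma measureReal_fewErrors_le_exp [IsProbabilityMeasure μ] (M : GaussianProbitModel μ x y β₀ β)
    (hn : 0 < n) {s : ℝ} (hs : ((d : ℝ) + 1) / n ≤ s) (hs1 : s ≤ 1) (hsh : s ≤ hConst β₀ ‖β‖) :
    μ.real (fewErrors x y) ≤ Real.exp (-((hConst β₀ ‖β‖ - s) ^ 2 / 2 -
      s * Real.log (Real.exp 1 / s)) * n) := by
  set h := hConst β₀ ‖β‖ with hh
  have hn' : (0 : ℝ) < n := by exact_mod_cast hn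
  have h0 : 0 < h := hConst_pos _ _
  have h1 : h ≤ 1 := hConst_le_one _ _
  have ha : 0 ≤ h - s := by linarith
  set a := h - s with ha'
  have hd : (d : ℝ) ≤ s * n := by
    rw [div_le_iff₀ hn'] at hs
    linarith
  have hexp : Real.exp (-a) ≤ 1 - a + a ^ 2 / 2 := by
    have h2 := Real.quadratic_le_exp_of_nonneg ha
    rw [Real.exp_neg, inv_le_iff_one_le_mul₀ (Real.exp_pos _)]
    have h3 : 0 ≤ 1 - a + a ^ 2 / 2 := by nlinarith [sq_nonneg (a - 1)]
    calc (1 : ℝ) ≤ (1 - a + a ^ 2 / 2) * (1 + a + a ^ 2 / 2) := by nlinarith [sq_nonneg (a ^ 2)]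
      _ ≤ _ := mul_le_mul_of_nonneg_left h2 h3
  have hbase : 1 - (1 - Real.exp (-a)) * h ≤ Real.exp (-(h * a) + a ^ 2 / 2) := by
    refine le_trans ?_ (Real.add_one_le_exp _)
    nlinarith [sq_nonneg a]
  have hbase0 : 0 ≤ 1 - (1 - Real.exp (-a)) * h := by
    have : Real.exp (-a) ≤ 1 := Real.exp_le_one_iff.2 (by linarith)
    nlinarith [Real.exp_pos (-a)]
  calc μ.real (fewErrors x y)
      ≤ Real.exp (a * d) * (Real.exp (n * (s * Real.log (Real.exp 1 / s))) *
          (1 - (1 - Real.exp (-a)) * h) ^ n) := measureReal_fewErrors_le M hn hs hs1 ha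
    _ ≤ Real.exp (a * (s * n)) * (Real.exp (n * (s * Real.log (Real.exp 1 / s))) *
          Real.exp (-(h * a) + a ^ 2 / 2) ^ n) := by gcongr
    _ = _ := by
        rw [← Real.exp_nat_mul, ← Real.exp_add, ← Real.exp_add]
        congr 1
        rw [ha']
        ring

/-- In the model, `L / m` is almost surely finite exactly outside the event of few errors. -/
lemma condNumber_lt_top_ae_eq (M : GaussianProbitModel μ x y β₀ β) :
    {ω | condNumber (fun i => consVec 1 (x i ω)) (fun i => y i ω) < ⊤} =ᵐ[μ]
      ((fewErrors x y)ᶜ : Set Ω) := by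
  filter_upwards [ae_general_position M.measurable_x M.indep_x M.law_x] with ω hω
  refine propext ?_
  change condNumber (fun i => consVec 1 (x i ω)) (fun i => y i ω) < ⊤ ↔ ω ∉ fewErrors x y
  rw [mem_fewErrors_iff, condNumber_lt_top_iff_forall_card]
  · push Not
    exact forall_congr' fun θ => Nat.succ_le_iff
  · intro S hS v hv
    refine hω S hS v fun i hi => ?_
    have hy : y i ω ≠ 0 := by rcases M.y_mem i ω with h | h <;> norm_num [h]
    simpa [real_inner_smul_left, hy] using hv i hi

end Model

end Probit

end

theorem corollary2p7 (β₀ γ₀ : ℝ) (hγ₀ : 0 ≤ γ₀) :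
    ∃ r ∈ Set.Ioo (0 : ℝ) 1,
      (∀ s ∈ Set.Ioo (0 : ℝ) 1,
        s + Real.sqrt (2 * s * Real.log (Real.exp 1 / s)) = Probit.hConst β₀ γ₀ ↔ s = r) ∧
      ∀ rbar ∈ Set.Ioo (0 : ℝ) r, ∃ c : ℝ, 0 < c ∧
        ∀ (n d : ℕ), 0 < n → ((d : ℝ) + 1) / n ≤ rbar →
        ∀ (Ω : Type*) [MeasurableSpace Ω] (μ : Measure Ω) [IsProbabilityMeasure μ]
          (x : Fin n → Ω → EuclideanSpace ℝ (Fin d)) (y : Fin n → Ω → ℝ)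
          (β : EuclideanSpace ℝ (Fin d)),
          Probit.GaussianProbitModel μ x y β₀ β →
          (∀ i, Var[fun ω => inner ℝ (x i ω) β; μ] = γ₀ ^ 2) →
          NullMeasurableSet
            {ω | Probit.condNumber (fun i => Probit.consVec 1 (x i ω)) (fun i => y i ω) < ⊤} μ ∧
          1 - Real.exp (-c * n) ≤
            μ.real
              {ω | Probit.condNumber (fun i => Probit.consVec 1 (x i ω)) (fun i => y i ω) < ⊤} := by
  obtain ⟨r, hr, hroot⟩ := Probit.exists_unique_threshold (Probit.hConst_pos β₀ γ₀)
    (Probit.hConst_le_one β₀ γ₀)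
  refine ⟨r, hr, hroot, fun s hs => ?_⟩
  have hs1 : s < 1 := hs.2.trans hr.2
  have hlt : s + √(2 * s * Real.log (Real.exp 1 / s)) < Probit.hConst β₀ γ₀ := by
    rw [← (hroot r hr).2 rfl]
    exact Probit.strictMonoOn_thresholdFun ⟨hs.1, hs1.le⟩ (Set.Ioo_subset_Ioc_self hr) hs.2
  have hsqrt := Real.sqrt_nonneg (2 * s * Real.log (Real.exp 1 / s))
  have hsq : 2 * s * Real.log (Real.exp 1 / s) < (Probit.hConst β₀ γ₀ - s) ^ 2 :=
    (Real.sqrt_lt' (by linarith)).1 (by linarith)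
  refine ⟨(Probit.hConst β₀ γ₀ - s) ^ 2 / 2 - s * Real.log (Real.exp 1 / s), by linarith, ?_⟩
  intro n d hn hnd Ω _ μ _ x y β M hvar
  have hβ : ‖β‖ = γ₀ := by
    have h := hvar ⟨0, hn⟩
    rw [Probit.variance_inner_covariate M] at h
    exact (sq_eq_sq₀ (norm_nonneg _) hγ₀).1 h
  have hmeas := Probit.measurableSet_fewErrors M.measurable_x M.measurable_y
  have hae := Probit.condNumber_lt_top_ae_eq M
  refine ⟨hmeas.compl.nullMeasurableSet.congr hae.symm, ?_⟩
  rw [(measureReal_congr hae).trans (probReal_compl_eq_one_sub hmeas)]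
  have hbound := Probit.measureReal_fewErrors_le_exp M hn hnd hs1.le (by rw [hβ]; linarith)
  rw [hβ] at hbound
  linarith
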